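/- Let $\alpha,\beta\in(0,1)$, $\rho>0$, and place two vortices at $a=(0,0)$ and $b=(\rho,0)$ in $\mathbb R^2$. Let $(r_a,\theta_a)$, $(r_b,\theta_b)$ be polar coordinates centred at $a$ and $b$, with counterclockwise angles in $(-\pi,\pi)$, where $\theta_a$ is cut along $(-\infty,0)\times\{0\}$ (and $\theta_a=0$ on the positive $x_1$ half-axis) and $\theta_b$ is cut along $(\rho,\infty)\times\{0\}$ (and $\theta_b=0$ on the segment from $b$ towards $a$). Let $A=-\alpha\,d\theta_a-\beta\,d\theta_b$, and let $H_0$ be the self-adjoint operator in $L^2(\mathbb R^2,d^2x)$ associated to the closure of the quadratic form $$\varphi\mapsto\int_{\mathbb R^2}\big(|(-i\partial_{x_1}-A_1)\varphi|^2+|(-i\partial_{x_2}-A_2)\varphi|^2\big)\,d^2x,\qquad \varphi\in C_c^\infty(\mathbb R^2\setminus\{a,b\}).$$ Let $U$ be the unitary operator of multiplication by $e^{i\alpha\theta_a+i\beta\theta_b}$ and let $H=UH_0U^{-1}$ be the two-vortex spinless Aharonov–Bohm Hamiltonian (formally $-\Delta$, with boundary conditions $\psi|_{\theta_a=\pi}=e^{2\pi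 i\alpha}\psi|_{\theta_a=-\pi}$ and $\psi|_{\theta_b=\pi}=e^{2\pi i\beta}\psi|_{\theta_b=-\pi}$, and the same for the normal derivatives, on the cuts). Let $X$ be the symmetric operator obtained by restricting $H$ to those functions of its domain that vanish in some neighbourhood of the vortices, and let $\mathcal N(z)=\operatorname{Ker}(X^*-z)$ be its deficiency subspaces. If $z\in\mathbb C\setminus[0,\infty)$ and $\psi\in\mathcal N(z)$, then there exist constants $c_{a,0},c_{a,-1},c_{b,0},c_{b,-1}\in\mathbb C$ such that $$\psi(x)=c_{a,0}\,r_a^{-\alpha}e^{i\alpha\theta_a}+c_{a,-1}\,r_a^{-1+\alpha}e^{i(\alpha-1)\theta_a}+o(1)\qquad\text{for }r_a\downarrow0$$ and $$\psi(x)=c_{b,0}\,r_b^{-\beta}e^{i\beta\theta_b}+c_{b,-1}\,r_b^{-1+\beta}e^{i(\beta-1)\theta_b}+o(1)\qquad\text{for }r_b\downarrow0.$$ Here $\psi$ is an element of $L^2$, and $o(1)$ means that the essential supremum of the modulus of the remainder over the disk of radius $\delta$ around the vortex tends to $0$ as $\delta\downarrow0$. -/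

import Mathlib

open MeasureTheory Filter Topology
open scoped ContDiff

noncomputable section

namespace AharonovBohm

/-- The Hilbert space `L²(ℝ², d²x)`; the plane is identified with `ℂ` through `x = x₁ + i x₂`,
and the vortices are `a = 0` and `b = ρ > 0`. -/
abbrev L2 : Type := Lp ℂ 2 (volume : Measure ℂ)

/-- The polar angle at the vortex `a = 0`, with the cut along the half-line `x₁ < 0`. -/
def thetaA (x : ℂ) : ℝ := Complex.arg x

/-- The (counterclockwise) polar angle at the vortex `b = ρ`, with the cut along the half-line
`x₁ > ρ`, so that it vanishes on the segment from `b` towards `a`. -/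
def thetaB (ρ : ℝ) (x : ℂ) : ℝ := Complex.arg ((ρ : ℂ) - x)

/-- Test functions on the plane without the two vortices: smooth, compactly supported, and zero
in a neighbourhood of each vortex. -/
def IsTest (ρ : ℝ) (φ : ℂ → ℂ) : Prop :=
  ContDiff ℝ ∞ φ ∧ HasCompactSupport φ ∧ φ =ᶠ[𝓝 0] 0 ∧ φ =ᶠ[𝓝 (ρ : ℂ)] 0

/-- First component of the vector potential `A = -α dθ_a - β dθ_b`. -/
def vecPot1 (α β ρ : ℝ) (x : ℂ) : ℝ :=
  α * x.im / ‖x‖ ^ 2 + β * x.im / ‖x - ρ‖ ^ 2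

/-- Second component of the vector potential `A = -α dθ_a - β dθ_b`. -/
def vecPot2 (α β ρ : ℝ) (x : ℂ) : ℝ :=
  -(α * x.re / ‖x‖ ^ 2) - β * (x.re - ρ) / ‖x - ρ‖ ^ 2

/-- `(-i ∂₁ - A₁) φ`. -/
def kin1 (α β ρ : ℝ) (φ : ℂ → ℂ) (x : ℂ) : ℂ :=
  -Complex.I * fderiv ℝ φ x 1 - vecPot1 α β ρ x * φ x

/-- `(-i ∂₂ - A₂) φ`. -/
def kin2 (α β ρ : ℝ) (φ : ℂ → ℂ) (x : ℂ) : ℂ :=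
  -Complex.I * fderiv ℝ φ x Complex.I - vecPot2 α β ρ x * φ x

theorem kin1_add {α β ρ : ℝ} {φ χ : ℂ → ℂ} (hφ : ContDiff ℝ ∞ φ) (hχ : ContDiff ℝ ∞ χ) :
    kin1 α β ρ (φ + χ) = kin1 α β ρ φ + kin1 α β ρ χ := by
  funext x
  have h1 := (hφ.differentiable (by simp)) x
  have h2 := (hχ.differentiable (by simp)) x
  simp only [kin1, Pi.add_apply, fderiv_add h1 h2, add_apply]
  ring

theorem kin2_add {α β ρ : ℝ} {φ χ : ℂ → ℂ} (hφ : ContDiff ℝ ∞ φ) (hχ : ContDiff ℝ ∞ χ) :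
    kin2 α β ρ (φ + χ) = kin2 α β ρ φ + kin2 α β ρ χ := by
  funext x
  have h1 := (hφ.differentiable (by simp)) x
  have h2 := (hχ.differentiable (by simp)) x
  simp only [kin2, Pi.add_apply, fderiv_add h1 h2, add_apply]
  ring

theorem kin1_smul {α β ρ : ℝ} {φ : ℂ → ℂ} (hφ : ContDiff ℝ ∞ φ) (c : ℂ) :
    kin1 α β ρ (c • φ) = c • kin1 α β ρ φ := by
  funext x
  have h1 := (hφ.differentiable (by simp)) x
  simp only [kin1, Pi.smul_apply, fderiv_const_smul h1, smul_apply, smul_eq_mul]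
  ring

theorem kin2_smul {α β ρ : ℝ} {φ : ℂ → ℂ} (hφ : ContDiff ℝ ∞ φ) (c : ℂ) :
    kin2 α β ρ (c • φ) = c • kin2 α β ρ φ := by
  funext x
  have h1 := (hφ.differentiable (by simp)) x
  simp only [kin2, Pi.smul_apply, fderiv_const_smul h1, smul_apply, smul_eq_mul]
  ring

/-- The graph of `φ ↦ ((-i∂₁ - A₁)φ, (-i∂₂ - A₂)φ)` on test functions. -/
def gradGraph (α β ρ : ℝ) : Submodule ℂ (L2 × L2 × L2) where
  carrier := {p | ∃ φ : ℂ → ℂ, IsTest ρ φ ∧ p.1 =ᵐ[volume] φ ∧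
    p.2.1 =ᵐ[volume] kin1 α β ρ φ ∧ p.2.2 =ᵐ[volume] kin2 α β ρ φ}
  zero_mem' := by
    have h1 : kin1 α β ρ 0 = 0 := by funext x; simp [kin1]
    have h2 : kin2 α β ρ 0 = 0 := by funext x; simp [kin2]
    refine ⟨0, ⟨contDiff_const, HasCompactSupport.zero, .rfl, .rfl⟩, ?_, ?_, ?_⟩
    · exact Lp.coeFn_zero _ _ _
    · rw [h1]; exact Lp.coeFn_zero _ _ _
    · rw [h2]; exact Lp.coeFn_zero _ _ _
  add_mem' := by
    rintro p q ⟨φ, ⟨a1, a2, a3, a4⟩, hp, hp1, hp2⟩ ⟨χ, ⟨b1, b2, b3, b4⟩, hq, hq1, hq2⟩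
    refine ⟨φ + χ, ⟨a1.add b1, a2.add b2, by simpa using a3.add b3, by simpa using a4.add b4⟩,
      ?_, ?_, ?_⟩
    · exact (Lp.coeFn_add _ _).trans (hp.add hq)
    · rw [kin1_add a1 b1]; exact (Lp.coeFn_add _ _).trans (hp1.add hq1)
    · rw [kin2_add a1 b1]; exact (Lp.coeFn_add _ _).trans (hp2.add hq2)
  smul_mem' := by
    rintro c p ⟨φ, ⟨a1, a2, a3, a4⟩, hp, hp1, hp2⟩
    refine ⟨c • φ, ⟨a1.const_smul c, a2.smul_left (f := fun _ => c),
      by simpa using a3.const_smul c, by simpa using a4.const_smul c⟩, ?_, ?_, ?_⟩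
    · exact (Lp.coeFn_smul _ _).trans (hp.const_smul c)
    · rw [kin1_smul a1]; exact (Lp.coeFn_smul _ _).trans (hp1.const_smul c)
    · rw [kin2_smul a1]; exact (Lp.coeFn_smul _ _).trans (hp2.const_smul c)

/-- The domain of the closure of the quadratic form
`∫ |(-i∂₁ - A₁)φ|² + |(-i∂₂ - A₂)φ|²` (first defined on test functions), together with the
limits of the two components: `(f, u₁, u₂)` belongs to `formGraph` if and only if there are test
functions `φ_n → f` in `L²` with `(-i∂_j - A_j)φ_n → u_j` in `L²`. The value of the closed
sesquilinear form at `f, f'` is `⟪u₁, u₁'⟫ + ⟪u₂, u₂'⟫`. -/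
def formGraph (α β ρ : ℝ) : Submodule ℂ (L2 × L2 × L2) :=
  (gradGraph α β ρ).topologicalClosure

/-- The graph of the operator `H₀` associated to the closed quadratic form: `H₀ f = g` if and only
if `f` is in the form domain and `q(φ, f) = ⟪φ, g⟫` for all `φ` in the form domain. -/
def hamiltonian0Graph (α β ρ : ℝ) : Submodule ℂ (L2 × L2) where
  carrier := {p | ∃ u₁ u₂ : L2, (p.1, u₁, u₂) ∈ formGraph α β ρ ∧
    ∀ φ v₁ v₂ : L2, (φ, v₁, v₂) ∈ formGraph α β ρ →
      inner ℂ v₁ u₁ + inner ℂ v₂ u₂ = inner ℂ φ p.2}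
  zero_mem' := ⟨0, 0, (formGraph α β ρ).zero_mem, by simp⟩
  add_mem' := by
    rintro p q ⟨u₁, u₂, hu, h⟩ ⟨w₁, w₂, hw, k⟩
    refine ⟨u₁ + w₁, u₂ + w₂, (formGraph α β ρ).add_mem hu hw, fun φ v₁ v₂ hv => ?_⟩
    simp only [Prod.snd_add, inner_add_right, ← h φ v₁ v₂ hv, ← k φ v₁ v₂ hv]
    ring
  smul_mem' := by
    rintro c p ⟨u₁, u₂, hu, h⟩
    refine ⟨c • u₁, c • u₂, (formGraph α β ρ).smul_mem c hu, fun φ v₁ v₂ hv => ?_⟩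
    simp only [Prod.smul_snd, inner_smul_right, ← h φ v₁ v₂ hv]
    ring

/-- The phase factor `exp(iαθ_a + iβθ_b)`. -/
def phase (α β ρ : ℝ) (x : ℂ) : ℂ :=
  Complex.exp (Complex.I * (α * thetaA x + β * thetaB ρ x))

/-- The graph of `H = U H₀ U⁻¹`, with `U` the multiplication by the phase factor: it consists of
the pairs `(U f₀, U g₀)` with `g₀ = H₀ f₀`. -/
def hamiltonianGraph (α β ρ : ℝ) : Submodule ℂ (L2 × L2) where
  carrier := {p | ∃ p₀ ∈ hamiltonian0Graph α β ρ,
    p.1 =ᵐ[volume] (fun x => phase α β ρ x * p₀.1 x) ∧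
    p.2 =ᵐ[volume] (fun x => phase α β ρ x * p₀.2 x)}
  zero_mem' := by
    refine ⟨0, zero_mem _, ?_, ?_⟩ <;>
    · filter_upwards [Lp.coeFn_zero ℂ 2 (volume : Measure ℂ)] with x hx
      simp
  add_mem' := by
    rintro p q ⟨p₀, hp, h1, h2⟩ ⟨q₀, hq, k1, k2⟩
    refine ⟨p₀ + q₀, add_mem hp hq, ?_, ?_⟩
    · filter_upwards [Lp.coeFn_add p.1 q.1, Lp.coeFn_add p₀.1 q₀.1, h1, k1] with x e1 e2 e3 e4
      simp only [Prod.fst_add, e1, e2, Pi.add_apply, e3, e4]; ring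
    · filter_upwards [Lp.coeFn_add p.2 q.2, Lp.coeFn_add p₀.2 q₀.2, h2, k2] with x e1 e2 e3 e4
      simp only [Prod.snd_add, e1, e2, Pi.add_apply, e3, e4]; ring
  smul_mem' := by
    rintro c p ⟨p₀, hp, h1, h2⟩
    refine ⟨c • p₀, Submodule.smul_mem _ c hp, ?_, ?_⟩
    · filter_upwards [Lp.coeFn_smul c p.1, Lp.coeFn_smul c p₀.1, h1] with x e1 e2 e3
      simp only [Prod.smul_fst, e1, e2, Pi.smul_apply, e3, smul_eq_mul]; ring
    · filter_upwards [Lp.coeFn_smul c p.2, Lp.coeFn_smul c p₀.2, h2] with x e1 e2 e3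
      simp only [Prod.smul_snd, e1, e2, Pi.smul_apply, e3, smul_eq_mul]; ring

theorem IsTest.fderiv_eventually {φ : ℂ → ℂ} {p : ℂ} (h : φ =ᶠ[𝓝 p] 0) (v : ℂ) :
    ∀ᶠ x in 𝓝 p, φ x = 0 ∧ fderiv ℝ φ x v = 0 := by
  filter_upwards [h.eventually_nhds] with x hx
  refine ⟨hx.self_of_nhds, ?_⟩
  rw [Filter.EventuallyEq.fderiv_eq hx]
  simp

theorem IsTest.continuous_combination {ρ : ℝ} {φ : ℂ → ℂ} (h : IsTest ρ φ) (v : ℂ)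
    {A : ℂ → ℝ} (hA : ∀ x : ℂ, x ≠ 0 → x ≠ ρ → ContinuousAt A x) :
    Continuous fun x => -Complex.I * fderiv ℝ φ x v - A x * φ x := by
  have hd : Continuous fun x => fderiv ℝ φ x v :=
    (h.1.continuous_fderiv (by simp)).clm_apply continuous_const
  have key : ∀ p : ℂ, φ =ᶠ[𝓝 p] 0 →
      ContinuousAt (fun x => -Complex.I * fderiv ℝ φ x v - A x * φ x) p := by
    intro p hp
    refine (continuousAt_const (y := (0 : ℂ))).congr ?_
    filter_upwards [IsTest.fderiv_eventually hp v] with x hx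
    simp [hx.1, hx.2]
  rw [continuous_iff_continuousAt]
  intro x
  by_cases h0 : x = 0
  · subst h0; exact key _ h.2.2.1
  by_cases h1 : x = ρ
  · subst h1; exact key _ h.2.2.2
  exact (continuousAt_const.mul hd.continuousAt).sub
    ((Complex.continuous_ofReal.continuousAt.comp (hA x h0 h1)).mul h.1.continuous.continuousAt)

theorem IsTest.hasCompactSupport_combination {ρ : ℝ} {φ : ℂ → ℂ} (h : IsTest ρ φ) (v : ℂ)
    (A : ℂ → ℝ) : HasCompactSupport fun x => -Complex.I * fderiv ℝ φ x v - A x * φ x := by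
  have h1 : HasCompactSupport fun x => fderiv ℝ φ x v := by
    refine (h.2.1.fderiv (𝕜 := ℝ)).mono ?_
    intro x hx
    simp only [Function.mem_support] at hx ⊢
    intro h0
    exact hx (by simp [h0])
  exact (h1.mul_left (f := fun _ => -Complex.I)).sub (h.2.1.mul_left (f := fun x => (A x : ℂ)))

theorem IsTest.memLp_kin1 {α β ρ : ℝ} {φ : ℂ → ℂ} (h : IsTest ρ φ) :
    MemLp (kin1 α β ρ φ) 2 volume := by
  refine (h.continuous_combination 1 ?_).memLp_of_hasCompactSupport
    (h.hasCompactSupport_combination 1 _)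
  intro x h0 h1
  unfold vecPot1
  have e0 : ‖x‖ ^ 2 ≠ 0 := by simpa using h0
  have e1 : ‖x - ρ‖ ^ 2 ≠ 0 := by simpa [sub_eq_zero] using h1
  have := Complex.continuous_im
  fun_prop (disch := assumption)

theorem IsTest.memLp_kin2 {α β ρ : ℝ} {φ : ℂ → ℂ} (h : IsTest ρ φ) :
    MemLp (kin2 α β ρ φ) 2 volume := by
  refine (h.continuous_combination Complex.I ?_).memLp_of_hasCompactSupport
    (h.hasCompactSupport_combination Complex.I _)
  intro x h0 h1
  unfold vecPot2
  have e0 : ‖x‖ ^ 2 ≠ 0 := by simpa using h0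
  have e1 : ‖x - ρ‖ ^ 2 ≠ 0 := by simpa [sub_eq_zero] using h1
  fun_prop (disch := assumption)

theorem IsTest.memLp {ρ : ℝ} {φ : ℂ → ℂ} (h : IsTest ρ φ) : MemLp φ 2 volume :=
  h.1.continuous.memLp_of_hasCompactSupport h.2.1

/-- Every test function belongs to the form domain. -/
theorem IsTest.mem_formGraph {α β ρ : ℝ} {φ : ℂ → ℂ} (h : IsTest ρ φ) :
    (h.memLp.toLp φ, (h.memLp_kin1 (α := α) (β := β)).toLp _,
      (h.memLp_kin2 (α := α) (β := β)).toLp _) ∈ formGraph α β ρ :=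
  Submodule.le_topologicalClosure _
    ⟨φ, h, h.memLp.coeFn_toLp, h.memLp_kin1.coeFn_toLp, h.memLp_kin2.coeFn_toLp⟩

theorem eq_zero_of_inner_test {ρ : ℝ} (g : L2)
    (hg : ∀ (φ : ℂ → ℂ) (h : IsTest ρ φ), inner ℂ (h.memLp.toLp φ) g = 0) : g = 0 := by
  have hU : IsOpen ({0, (ρ : ℂ)}ᶜ : Set ℂ) := (Set.toFinite _).isClosed.isOpen_compl
  have hloc : LocallyIntegrable (g : ℂ → ℂ) volume :=
    (Lp.memLp g).locallyIntegrable (by norm_num)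
  have key := hU.ae_eq_zero_of_integral_contDiff_smul_eq_zero
    (hloc.locallyIntegrableOn ({0, (ρ : ℂ)}ᶜ : Set ℂ)) ?_
  · have hnull : ∀ᵐ x : ℂ, x ∈ ({0, (ρ : ℂ)}ᶜ : Set ℂ) := by
      exact compl_mem_ae_iff.2 ((Set.toFinite ({0, (ρ : ℂ)} : Set ℂ)).measure_zero volume)
    rw [Lp.eq_zero_iff_ae_eq_zero]
    filter_upwards [key, hnull] with x h1 h2 using h1 h2
  intro k hk hc hs
  have ht : IsTest ρ (fun x => (k x : ℂ)) := by
    refine ⟨Complex.ofRealCLM.contDiff.comp hk, hc.comp_left (g := fun t : ℝ => (t : ℂ)) (by simp),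
      ?_, ?_⟩
    · have : (0 : ℂ) ∉ tsupport k := fun h => hs h (by simp)
      filter_upwards [notMem_tsupport_iff_eventuallyEq.1 this] with x hx
      simp [hx]
    · have : (ρ : ℂ) ∉ tsupport k := fun h => hs h (by simp)
      filter_upwards [notMem_tsupport_iff_eventuallyEq.1 this] with x hx
      simp [hx]
  have := hg _ ht
  rw [L2.inner_def] at this
  rw [← this]
  refine integral_congr_ae ?_
  filter_upwards [ht.memLp.coeFn_toLp] with x hx
  rw [hx]
  simp [mul_comm]

theorem hamiltonian0Graph_singleValued (α β ρ : ℝ) :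
    ∀ p ∈ hamiltonian0Graph α β ρ, p.1 = 0 → p.2 = 0 := by
  rintro ⟨f, g⟩ ⟨u₁, u₂, hu, h⟩ hf
  simp only at hf h hu ⊢
  subst hf
  have h0 := h _ _ _ hu
  rw [inner_zero_left, inner_self_eq_norm_sq_to_K, inner_self_eq_norm_sq_to_K] at h0
  have h0' : ‖u₁‖ ^ 2 + ‖u₂‖ ^ 2 = 0 := by
    apply Complex.ofReal_injective
    push_cast
    exact h0
  have e1 : u₁ = 0 := by
    have : ‖u₁‖ ^ 2 = 0 := by nlinarith [sq_nonneg ‖u₁‖, sq_nonneg ‖u₂‖]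
    simpa using this
  have e2 : u₂ = 0 := by
    have : ‖u₂‖ ^ 2 = 0 := by nlinarith [sq_nonneg ‖u₁‖, sq_nonneg ‖u₂‖]
    simpa using this
  refine eq_zero_of_inner_test (ρ := ρ) g fun φ hφ => ?_
  rw [← h _ _ _ (hφ.mem_formGraph (α := α) (β := β)), e1, e2]
  simp

/-- The relation `hamiltonianGraph` is indeed the graph of an operator. -/
theorem hamiltonianGraph_singleValued (α β ρ : ℝ) :
    ∀ p ∈ hamiltonianGraph α β ρ, p.1 = 0 → p.2 = 0 := by
  rintro p ⟨p₀, hp₀, h1, h2⟩ hp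
  have : p₀.1 = 0 := by
    rw [Lp.eq_zero_iff_ae_eq_zero]
    rw [hp] at h1
    filter_upwards [h1, Lp.coeFn_zero ℂ 2 (volume : Measure ℂ)] with x e1 e2
    rw [e2] at e1
    simpa [phase, Complex.exp_ne_zero] using e1.symm
  have h3 := hamiltonian0Graph_singleValued α β ρ p₀ hp₀ this
  rw [Lp.eq_zero_iff_ae_eq_zero]
  rw [h3] at h2
  filter_upwards [h2, Lp.coeFn_zero ℂ 2 (volume : Measure ℂ)] with x e1 e2
  rw [e1, e2]
  simp

/-- The two-vortex Aharonov-Bohm Hamiltonian `H = U H₀ U⁻¹`, formally `-Δ` with the boundary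
conditions on the two cuts. -/
def hamiltonian (α β ρ : ℝ) : L2 →ₗ.[ℂ] L2 := (hamiltonianGraph α β ρ).toLinearPMap

theorem hamiltonian_graph (α β ρ : ℝ) :
    (hamiltonian α β ρ).graph = hamiltonianGraph α β ρ :=
  Submodule.toLinearPMap_graph_eq _ (hamiltonianGraph_singleValued α β ρ)

/-- The elements of `L²` that vanish (almost everywhere) in some neighbourhood of the vortices. -/
def vanishNearVortices (ρ : ℝ) : Submodule ℂ L2 where
  carrier := {f | ∃ ε > 0, ∀ᵐ x : ℂ, (‖x‖ < ε ∨ ‖x - ρ‖ < ε) → f x = 0}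
  zero_mem' := by
    refine ⟨1, one_pos, ?_⟩
    filter_upwards [Lp.coeFn_zero ℂ 2 (volume : Measure ℂ)] with x hx _ using hx
  add_mem' := by
    rintro f g ⟨ε, hε, hf⟩ ⟨δ, hδ, hg⟩
    refine ⟨min ε δ, lt_min hε hδ, ?_⟩
    filter_upwards [hf, hg, Lp.coeFn_add f g] with x e1 e2 e3 hx
    rw [e3, Pi.add_apply, e1 (hx.imp (lt_min_iff.1 · |>.1) (lt_min_iff.1 · |>.1)),
      e2 (hx.imp (lt_min_iff.1 · |>.2) (lt_min_iff.1 · |>.2)), add_zero]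
  smul_mem' := by
    rintro c f ⟨ε, hε, hf⟩
    refine ⟨ε, hε, ?_⟩
    filter_upwards [hf, Lp.coeFn_smul c f] with x e1 e2 hx
    rw [e2, Pi.smul_apply, e1 hx, smul_zero]

/-- The symmetric operator `X`: the restriction of `H` to the functions of its domain that vanish
in some neighbourhood of the vortices. -/
def symmOp (α β ρ : ℝ) : L2 →ₗ.[ℂ] L2 :=
  (hamiltonian α β ρ).domRestrict (vanishNearVortices ρ)

/-- The deficiency subspace `𝒩(z) = Ker(X* - z)`. -/
def deficiencySpace (α β ρ : ℝ) (z : ℂ) : Submodule ℂ L2 :=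
  (LinearMap.ker ((symmOp α β ρ).adjoint.toFun -
    z • (symmOp α β ρ).adjoint.domain.subtype)).map (symmOp α β ρ).adjoint.domain.subtype

end AharonovBohm

end

/-! Membership of ψ in Ker(X* - z) means that ψ is orthogonal to (X - z̄)Uφ for all test functions
φ. This is the equation -Δψ = zψ away from the vortices, in a weak form that contains the twisted
boundary conditions (`isWeakSolution_of_mem_deficiencySpace`). Taking for φ a radial function times
an angular exponential, supported in an annulus around a, separates variables. With t = log r, the
m-th angular Fourier coefficient F of e^{-iαθ}ψ solves F'' = (ν² - z e^{2t})F weakly near t = -∞,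
where ν = |m + α| and e^t F is square integrable (`isModeSolution_angularMode`).

Regarding -z e^{2t}F as a source, variation of constants gives F = A e^{νt} + B e^{-νt} + (Green
term). If m = 0 or m = -1, then ν < 1 and r^{-ν} is square integrable near the vortex, so B may
survive: these are the terms r^{-α} and r^{-1+α}, and the rest of the mode is O(r^ν). For every
other m one has ν > 1, square integrability forces B = 0, and the mode is at most K|m|^{-3/2} r with
K independent of m (`IsModeSolution.exists_norm_le`). These bounds are summable, so the Fourier
series of the remainder converges absolutely and is O(r^α + r^{1-α} + r)
(`exists_singular_expansion`).

No elliptic regularity is needed: the one-dimensional weak equation is solved by duality with test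
functions (`exists_eq_exp_add_greenConv`). The expansion at b follows from the one at a by the
half-turn x ↦ ρ - x, which exchanges the vortices and the fluxes (`IsWeakSolution.reflect`). -/

/-! ### Weak solutions of `F'' - ν² F = h` on a half-line -/

namespace AharonovBohm

/-- Smooth functions on the line whose support is a compact subset of `(-∞, T)`. -/
def testOn (T : ℝ) : Submodule ℂ (ℝ → ℂ) where
  carrier := {g | ContDiff ℝ ∞ g ∧ ∃ a b : ℝ, b < T ∧ ∀ t, g t ≠ 0 → a < t ∧ t < b}
  zero_mem' := ⟨contDiff_const, 0, T - 1, by linarith, fun t h => absurd rfl h⟩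
  add_mem' := by
    rintro g k ⟨hg, a, b, hb, h⟩ ⟨hk, a', b', hb', h'⟩
    refine ⟨hg.add hk, min a a', max b b', max_lt hb hb', fun t ht => ?_⟩
    by_cases h0 : g t = 0
    · have h1 : k t ≠ 0 := fun h1 => ht (by simp [h0, h1])
      exact ⟨min_lt_of_right_lt (h' t h1).1, lt_max_of_lt_right (h' t h1).2⟩
    · exact ⟨min_lt_of_left_lt (h t h0).1, lt_max_of_lt_left (h t h0).2⟩
  smul_mem' := by
    rintro c g ⟨hg, a, b, hb, h⟩
    exact ⟨contDiff_const.smul hg, a, b, hb, fun t ht => h t fun h0 => ht (by simp [h0])⟩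

theorem hasCompactSupport_of_mem_testOn {T : ℝ} {g : ℝ → ℂ} (hg : g ∈ testOn T) :
    HasCompactSupport g := by
  obtain ⟨-, a, b, -, h⟩ := hg
  refine HasCompactSupport.of_support_subset_isCompact (K := Set.Icc a b) isCompact_Icc ?_
  exact fun t ht => ⟨(h t ht).1.le, (h t ht).2.le⟩

theorem continuous_of_mem_testOn {T : ℝ} {g : ℝ → ℂ} (hg : g ∈ testOn T) : Continuous g :=
  hg.1.continuous

theorem deriv_mem_testOn {T : ℝ} {g : ℝ → ℂ} (hg : g ∈ testOn T) : deriv g ∈ testOn T := by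
  obtain ⟨hs, a, b, hb, h⟩ := hg
  have hz : ∀ t, t ∉ Set.Icc a b → deriv g t = 0 := by
    intro t ht
    have : g =ᶠ[𝓝 t] 0 := by
      filter_upwards [isClosed_Icc.isOpen_compl.mem_nhds ht] with s hs
      by_contra h0
      exact hs ⟨(h s h0).1.le, (h s h0).2.le⟩
    rw [this.deriv_eq]
    simp
  -- The derivative is only known to vanish off the closed interval [a, b]; the strict inequalities
  -- require a larger interval, still ending below T.
  refine ⟨(contDiff_infty_iff_deriv.1 hs).2, a - 1, (b + T) / 2, by linarith, fun t ht => ?_⟩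
  by_contra h0
  refine ht (hz t fun h1 => h0 ⟨?_, ?_⟩)
  · linarith [h1.1]
  · linarith [h1.2]

theorem integrable_of_mem_testOn {T : ℝ} {g : ℝ → ℂ} (hg : g ∈ testOn T) {k : ℝ → ℂ}
    (hk : Continuous k) : Integrable (fun t => k t * g t) :=
  (hk.mul (continuous_of_mem_testOn hg)).integrable_of_hasCompactSupport
    (hasCompactSupport_of_mem_testOn hg).mul_left

/-- A test function with vanishing exponential moments is `g'' - ν² g` for the test function `g`
obtained by convolution with the Green function. -/
theorem exists_testOn_green {T ν : ℝ} (hν : 0 < ν) {φ : ℝ → ℂ} (hφ : φ ∈ testOn T)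
    (h1 : ∫ s : ℝ, Complex.exp (ν * s) * φ s = 0) (h2 : ∫ s : ℝ, Complex.exp (-ν * s) * φ s = 0) :
    ∃ g ∈ testOn T, (∀ t, deriv (deriv g) t - ν ^ 2 * g t = φ t) ∧
      ∀ t, g t = -(1 / (2 * ν)) * ∫ s, (Real.exp (-ν * |t - s|) : ℂ) * φ s := by
  obtain ⟨hs, a, b, hb, h⟩ := id hφ
  have hc := continuous_of_mem_testOn hφ
  have hν' : (ν : ℂ) ≠ 0 := by exact_mod_cast hν.ne'
  have hcE : ∀ σ : ℂ, Continuous fun s : ℝ => Complex.exp (σ * s) := fun σ => by fun_prop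
  have hcI : ∀ σ : ℂ, Continuous fun s : ℝ => Complex.exp (σ * s) * φ s :=
    fun σ => (hcE σ).mul hc
  have hI : ∀ σ : ℂ, Integrable fun s : ℝ => Complex.exp (σ * s) * φ s :=
    fun σ => integrable_of_mem_testOn hφ (hcE σ)
  set P : ℂ → ℝ → ℂ := fun σ t => ∫ s in a..t, Complex.exp (σ * s) * φ s with hP
  have hPd : ∀ (σ : ℂ) (t : ℝ), HasDerivAt (P σ) (Complex.exp (σ * t) * φ t) t := fun σ t =>
    ((hcI σ).integral_hasStrictDerivAt a t).hasDerivAt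
  have hEs : ∀ σ : ℂ, ContDiff ℝ ∞ fun s : ℝ => Complex.exp (σ * s) := fun σ =>
    (contDiff_const.mul Complex.ofRealCLM.contDiff).cexp
  have hPs : ∀ σ, ContDiff ℝ ∞ (P σ) := by
    intro σ
    rw [contDiff_infty_iff_deriv]
    refine ⟨fun t => (hPd σ t).differentiableAt, ?_⟩
    have : deriv (P σ) = fun s : ℝ => Complex.exp (σ * s) * φ s := funext fun t => (hPd σ t).deriv
    rw [this]
    exact (hEs σ).mul hs
  have hPI : ∀ σ t, P σ t = ∫ s in Set.Iic t, Complex.exp (σ * s) * φ s := by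
    intro σ t
    rw [hP]
    simp only
    rw [← intervalIntegral.integral_Iic_sub_Iic (hI σ).integrableOn (hI σ).integrableOn,
      setIntegral_eq_zero_of_forall_eq_zero (t := Set.Iic a), sub_zero]
    intro s hs
    have : φ s = 0 := by
      by_contra h0
      exact absurd (h s h0).1 (not_lt.2 hs)
    simp [this]
  have hPII : ∀ σ t, (∫ s : ℝ, Complex.exp (σ * s) * φ s) = 0 →
      P σ t = -∫ s in Set.Ioi t, Complex.exp (σ * s) * φ s := by
    intro σ t h0
    have := integral_add_compl (measurableSet_Iic (a := t)) (hI σ)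
    rw [Set.compl_Iic, h0] at this
    rw [hPI]
    exact eq_neg_of_add_eq_zero_left this
  -- Variation of constants. In g' the two terms containing φ cancel, because e^{νt} and e^{-νt} are
  -- inverse to each other; in g'' they add up to φ.
  set g : ℝ → ℂ := fun t => 1 / (2 * ν) *
    (Complex.exp (ν * t) * P (-ν) t - Complex.exp (-ν * t) * P ν t) with hg
  have hEd : ∀ (σ : ℂ) (t : ℝ),
      HasDerivAt (fun s : ℝ => Complex.exp (σ * s)) (Complex.exp (σ * t) * σ) t := by
    intro σ t
    have := (((hasDerivAt_id (t : ℂ)).const_mul σ).cexp).comp_ofReal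
    simpa using this
  have hee : ∀ t : ℝ, Complex.exp (ν * t) * Complex.exp (-ν * t) = 1 := by
    intro t; rw [← Complex.exp_add]; simp
  have hgd : ∀ t : ℝ, HasDerivAt g
      (1 / 2 * (Complex.exp (ν * t) * P (-ν) t + Complex.exp (-ν * t) * P ν t)) t := by
    intro t
    have := ((((hEd ν t).mul (hPd (-ν) t)).sub ((hEd (-ν) t).mul (hPd ν t))).const_mul
      (1 / (2 * (ν : ℂ))))
    refine this.congr_deriv ?_
    field_simp
    ring
  have hgd2 : ∀ t : ℝ, HasDerivAt (deriv g) (ν ^ 2 * g t + φ t) t := by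
    intro t
    have e : deriv g = fun t : ℝ =>
        1 / 2 * (Complex.exp (ν * t) * P (-ν) t + Complex.exp (-ν * t) * P ν t) :=
      funext fun t => (hgd t).deriv
    rw [e]
    have := ((((hEd ν t).mul (hPd (-ν) t)).add ((hEd (-ν) t).mul (hPd ν t))).const_mul
      (1 / 2 : ℂ))
    refine this.congr_deriv ?_
    have := hee t
    rw [neg_mul] at this
    simp only [hg, neg_mul]
    field_simp
    linear_combination 2 * φ t * this
  refine ⟨g, ⟨?_, a, b, hb, ?_⟩, fun t => ?_, fun t => ?_⟩
  · exact contDiff_const.mul (((hEs ν).mul (hPs _)).sub ((hEs (-ν)).mul (hPs _)))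
  · intro t ht
    by_contra h0
    rw [not_and_or, not_lt, not_lt] at h0
    -- Below a the primitives vanish trivially. Beyond b the primitive equals minus the remaining
    -- tail, which is empty: this is where the vanishing moments give compact support.
    have hz : ∀ σ, (∫ s : ℝ, Complex.exp (σ * s) * φ s) = 0 → P σ t = 0 := by
      intro σ h3
      rcases h0 with h0 | h0
      · rw [hPI, setIntegral_eq_zero_of_forall_eq_zero]
        intro s hs
        have : φ s = 0 := by
          by_contra h4
          exact absurd (h s h4).1 (not_lt.2 (le_trans hs h0))
        simp [this]
      · rw [hPII _ _ h3, setIntegral_eq_zero_of_forall_eq_zero, neg_zero]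
        intro s hs
        have : φ s = 0 := by
          by_contra h4
          exact absurd (h s h4).2 (not_lt.2 (le_trans h0 (le_of_lt hs)))
        simp [this]
    exact ht (by simp [hg, hz _ h1, hz _ h2])
  · rw [(hgd2 t).deriv]; ring
  · have hK : Integrable fun s : ℝ => (Real.exp (-ν * |t - s|) : ℂ) * φ s :=
      integrable_of_mem_testOn hφ (by fun_prop)
    -- The kernel is a single exponential on each side of s = t; the vanishing moment turns the tail
    -- over s > t into -P(-ν).
    rw [← integral_add_compl (measurableSet_Iic (a := t)) hK, Set.compl_Iic]
    have e1 : ∫ s in Set.Iic t, (Real.exp (-ν * |t - s|) : ℂ) * φ s =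
        Complex.exp (-ν * t) * P ν t := by
      rw [hPI, ← integral_const_mul]
      refine setIntegral_congr_fun measurableSet_Iic fun s hs => ?_
      rw [abs_of_nonneg (sub_nonneg.2 hs), ← mul_assoc, ← Complex.exp_add]
      push_cast
      ring_nf
    have e2 : ∫ s in Set.Ioi t, (Real.exp (-ν * |t - s|) : ℂ) * φ s =
        -(Complex.exp (ν * t) * P (-ν) t) := by
      rw [hPII _ _ h2, mul_neg, neg_neg, ← integral_const_mul]
      refine setIntegral_congr_fun measurableSet_Ioi fun s hs => ?_
      rw [abs_of_neg (sub_neg.2 hs), ← mul_assoc, ← Complex.exp_add]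
      push_cast
      ring_nf
    rw [e1, e2, hg]
    ring

/-- Convolution with the Green function of `d²/dt² - ν²`. -/
noncomputable def greenConv (ν : ℝ) (h : ℝ → ℂ) (s : ℝ) : ℂ :=
  -(1 / (2 * ν)) * ∫ t, (Real.exp (-ν * |t - s|) : ℂ) * h t

theorem norm_exp_neg_mul_abs_le {ν : ℝ} (hν : 0 < ν) (t : ℝ) :
    ‖(Real.exp (-ν * |t|) : ℂ)‖ ≤ 1 := by
  rw [Complex.norm_real, Real.norm_eq_abs, Real.abs_exp, Real.exp_le_one_iff]
  nlinarith [abs_nonneg t]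

theorem integrable_green_kernel {ν : ℝ} (hν : 0 < ν) {h φ : ℝ → ℂ} (hh : Integrable h)
    (hφ : Integrable φ) :
    Integrable (fun p : ℝ × ℝ => (Real.exp (-ν * |p.1 - p.2|) : ℂ) * (h p.1 * φ p.2))
      (volume.prod volume) := by
  refine (hh.mul_prod hφ).bdd_mul (c := 1) ?_ ?_
  · exact Continuous.aestronglyMeasurable (by fun_prop)
  · exact Eventually.of_forall fun p => norm_exp_neg_mul_abs_le hν _

/-- Fubini and the symmetry of the kernel move the convolution onto φ, where it becomes the function
g supplied by `exists_testOn_green`. -/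
theorem integral_greenConv_mul {ν : ℝ} (hν : 0 < ν) {h φ : ℝ → ℂ} (hh : Integrable h)
    (hφ : Integrable φ) :
    ∫ s, greenConv ν h s * φ s =
      ∫ t, h t * (-(1 / (2 * ν)) * ∫ s, (Real.exp (-ν * |t - s|) : ℂ) * φ s) := by
  have := integral_integral_swap
    (f := fun t s : ℝ => (Real.exp (-ν * |t - s|) : ℂ) * (h t * φ s))
    (integrable_green_kernel hν hh hφ)
  simp only [greenConv]
  have e1 : ∀ s, (-(1 / (2 * ν)) * ∫ t, (Real.exp (-ν * |t - s|) : ℂ) * h t) * φ s =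
      -(1 / (2 * ν)) * ∫ t, (Real.exp (-ν * |t - s|) : ℂ) * (h t * φ s) := by
    intro s
    rw [mul_assoc, ← integral_mul_const]
    simp only [mul_assoc]
  have e2 : ∀ t, h t * (-(1 / (2 * ν)) * ∫ s, (Real.exp (-ν * |t - s|) : ℂ) * φ s) =
      -(1 / (2 * ν)) * ∫ s, (Real.exp (-ν * |t - s|) : ℂ) * (h t * φ s) := by
    intro t
    rw [mul_left_comm, ← integral_const_mul]
    congr 2
    ext s
    ring
  simp only [e1, e2]
  rw [integral_const_mul, integral_const_mul, this]

theorem norm_greenConv_le {ν : ℝ} (h : ℝ → ℂ) (hν : 0 < ν) (s : ℝ) :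
    ‖greenConv ν h s‖ ≤ 1 / (2 * ν) * ∫ t, Real.exp (-ν * |t - s|) * ‖h t‖ := by
  have h0 : ‖-(1 / (2 * (ν : ℂ)))‖ = 1 / (2 * ν) := by
    rw [norm_neg, show (1 / (2 * (ν : ℂ))) = ((1 / (2 * ν) : ℝ) : ℂ) by push_cast; ring,
      Complex.norm_real, Real.norm_of_nonneg (by positivity)]
  rw [greenConv, norm_mul, h0]
  gcongr
  refine (norm_integral_le_integral_norm _).trans_eq ?_
  congr 1
  ext t
  rw [norm_mul, Complex.norm_real, Real.norm_eq_abs, Real.abs_exp]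

theorem continuous_greenConv {ν : ℝ} (hν : 0 < ν) {h : ℝ → ℂ} (hh : Integrable h) :
    Continuous (greenConv ν h) := by
  refine continuous_const.mul ?_
  refine continuous_of_dominated (bound := fun t => ‖h t‖) ?_ ?_ hh.norm ?_
  · intro s
    exact (Continuous.aestronglyMeasurable (by fun_prop)).mul hh.aestronglyMeasurable
  · intro s
    refine Eventually.of_forall fun t => ?_
    rw [norm_mul]
    exact mul_le_of_le_one_left (norm_nonneg _) (norm_exp_neg_mul_abs_le hν _)
  · exact Eventually.of_forall fun t => by fun_prop

/-- A weak solution of `F'' - ν² F = h` on `(-∞, T)` is given by the variation of constants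
formula. -/
theorem exists_eq_exp_add_greenConv {T ν : ℝ} (hν : 0 < ν) {F h : ℝ → ℂ}
    (hF : LocallyIntegrable F) (hh : Integrable h)
    (hw : ∀ g ∈ testOn T, ∫ t, F t * (deriv (deriv g) t - ν ^ 2 * g t) = ∫ t, h t * g t) :
    ∃ A B : ℂ, ∀ᵐ t : ℝ, t < T →
      F t = A * Complex.exp (ν * t) + B * Complex.exp (-ν * t) + greenConv ν h t := by
  have hG := (continuous_greenConv hν hh)
  have hlin : ∀ {k : ℝ → ℂ}, LocallyIntegrable k → ∀ φ ∈ testOn T,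
      Integrable fun t => k t * φ t := by
    intro k hk φ hφ
    have := hk.integrable_smul_left_of_hasCompactSupport (continuous_of_mem_testOn hφ)
      (hasCompactSupport_of_mem_testOn hφ)
    exact this.congr (Eventually.of_forall fun t => by simp [mul_comm])
  let M : (k : ℝ → ℂ) → LocallyIntegrable k → (testOn T →ₗ[ℂ] ℂ) := fun k hk =>
    { toFun := fun φ => ∫ t, k t * φ.1 t
      map_add' := by
        intro φ χ
        rw [← integral_add (hlin hk _ φ.2) (hlin hk _ χ.2)]
        simp [mul_add]
      map_smul' := by
        intro c φ
        rw [RingHom.id_apply, smul_eq_mul, ← integral_const_mul]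
        congr 1
        ext t
        simp only [Submodule.coe_smul, Pi.smul_apply, smul_eq_mul]
        ring }
  have hE : ∀ σ : ℂ, Continuous fun t : ℝ => Complex.exp (σ * t) := fun σ => by fun_prop
  let E : Bool → (testOn T →ₗ[ℂ] ℂ) := fun b =>
    if b then M _ (hE ν).locallyIntegrable else M _ (hE (-ν)).locallyIntegrable
  have hFG : LocallyIntegrable (F - greenConv ν h) := hF.sub hG.locallyIntegrable
  -- Duality: a functional that vanishes on the common kernel of finitely many functionals is a
  -- combination of them. A test function with both exponential moments zero has the form g'' - ν²g
  -- with g again a test function, so the weak equation shows that F minus the Green term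
  -- annihilates it.
  have key : M _ hFG ∈ Submodule.span ℂ (Set.range E) := by
    refine mem_span_of_iInf_ker_le_ker ?_
    rintro ⟨φ, hφ⟩ hk
    rw [Submodule.mem_iInf] at hk
    have k1 : ∫ s : ℝ, Complex.exp (ν * s) * φ s = 0 := hk true
    have k2 : ∫ s : ℝ, Complex.exp (-ν * s) * φ s = 0 := hk false
    obtain ⟨g, hg, hg1, hg2⟩ := exists_testOn_green hν hφ k1 k2
    have hφi : Integrable φ := by simpa using integrable_of_mem_testOn hφ continuous_one
    change ∫ t, (F - greenConv ν h) t * φ t = 0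
    simp only [Pi.sub_apply, sub_mul]
    rw [integral_sub (hlin hF _ hφ) (hlin hG.locallyIntegrable _ hφ),
      integral_greenConv_mul hν hh hφi]
    have := hw g hg
    simp only [hg1] at this
    rw [this, sub_eq_zero]
    simp only [← hg2]
  obtain ⟨c, hc⟩ := (Submodule.mem_span_range_iff_exists_fun ℂ).1 key
  refine ⟨c true, c false, ?_⟩
  set R : ℝ → ℂ := fun t => F t - greenConv ν h t -
    (c true * Complex.exp (ν * t) + c false * Complex.exp (-ν * t)) with hR
  have hRl : LocallyIntegrable R := hFG.sub
    (((continuous_const.mul (hE ν)).add (continuous_const.mul (hE (-ν)))).locallyIntegrable)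
  have hz := isOpen_Iio.ae_eq_zero_of_integral_contDiff_smul_eq_zero (U := Set.Iio T)
    (hRl.locallyIntegrableOn _) ?_
  · filter_upwards [hz] with t ht h1
    have := ht h1
    simp only [hR] at this
    linear_combination this
  · intro k hk hkc hks
    have hkt : (fun t => (k t : ℂ)) ∈ testOn T := by
      refine ⟨Complex.ofRealCLM.contDiff.comp hk, ?_⟩
      -- A nonempty compact support has a largest point x < T, and (x + T)/2 separates it from T; an
      -- empty support has no such point.
      rcases Set.eq_empty_or_nonempty (tsupport k) with he | hne
      · refine ⟨T - 2, T - 1, by linarith, fun t ht => ?_⟩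
        rw [tsupport_eq_empty_iff] at he
        simp [he] at ht
      · obtain ⟨x, hx, hxm⟩ := hkc.isCompact.exists_isGreatest hne
        obtain ⟨y, hy, hym⟩ := hkc.isCompact.exists_isLeast hne
        have hxT : x < T := hks hx
        refine ⟨y - 1, (x + T) / 2, by linarith, fun t ht => ?_⟩
        have : t ∈ tsupport k := subset_tsupport _ (by simpa using ht)
        have := hxm this
        have := hym ‹t ∈ tsupport k›
        constructor <;> linarith
    have e := LinearMap.congr_fun hc ⟨_, hkt⟩
    simp only [Fintype.sum_bool, LinearMap.add_apply, LinearMap.smul_apply, smul_eq_mul] at e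
    change c true * (∫ t : ℝ, Complex.exp (ν * t) * k t) +
      c false * (∫ t : ℝ, Complex.exp (-ν * t) * k t) =
        ∫ t : ℝ, (F - greenConv ν h) t * k t at e
    have e3 : ∀ t, k t • R t = (F - greenConv ν h) t * k t -
        (c true * (Complex.exp (ν * t) * k t) + c false * (Complex.exp (-ν * t) * k t)) := by
      intro t
      simp only [hR, Complex.real_smul, Pi.sub_apply]
      ring
    simp only [e3]
    have i1 := integrable_of_mem_testOn hkt (hE ν)
    have i2 := integrable_of_mem_testOn hkt (hE (-ν))
    have i3 : Integrable fun t : ℝ => c true * (Complex.exp (ν * t) * k t) +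
        c false * (Complex.exp (-ν * t) * k t) := (i1.const_mul _).add (i2.const_mul _)
    rw [integral_sub (hlin hFG _ hkt) i3,
      integral_add (i1.const_mul _) (i2.const_mul _), integral_const_mul, integral_const_mul,
      ← e, sub_self]

end AharonovBohm

/-! ### Bounds for the Green function of `d²/dt² - ν²` -/

namespace AharonovBohm

theorem integral_exp_neg_mul_abs {a : ℝ} (ha : 0 < a) :
    ∫ t : ℝ, Real.exp (-a * |t|) = 2 / a := by
  rw [integral_comp_abs (f := fun t => Real.exp (-a * t)),
    integral_exp_mul_Ioi (neg_lt_zero.2 ha)]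
  simp
  ring

theorem integrable_exp_neg_mul_abs {a : ℝ} (ha : 0 < a) :
    Integrable fun t : ℝ => Real.exp (-a * |t|) := by
  -- A non-integrable function would have integral 0 by convention, whereas the value found above is
  -- 2/a > 0.
  by_contra h
  have := integral_undef h
  rw [integral_exp_neg_mul_abs ha] at this
  have : 0 < 2 / a := by positivity
  linarith

/-- Weighted form of 2fu ≤ f²/K + K u², used in place of Cauchy–Schwarz: with K bounding the L² norm
of f, the result is linear in K and no square root of Q appears. -/
theorem integral_mul_norm_le {w f u : ℝ → ℝ} {h : ℝ → ℂ} {c K Q : ℝ} (hc : 0 ≤ c) (hK : 0 < K)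
    (hw : ∀ t, 0 ≤ w t) (hle : ∀ t, w t * ‖h t‖ ≤ c * (f t * u t))
    (hf : Integrable fun t => f t ^ 2) (hfK : ∫ t, f t ^ 2 ≤ K ^ 2)
    (hu : Integrable fun t => u t ^ 2) (huQ : ∫ t, u t ^ 2 ≤ Q) :
    ∫ t, w t * ‖h t‖ ≤ c * (K * (1 + Q) / 2) := by
  have hI : Integrable fun t => c * ((f t ^ 2 / K + K * u t ^ 2) / 2) :=
    (((hf.div_const K).add (hu.const_mul K)).div_const 2).const_mul c
  calc ∫ t, w t * ‖h t‖ ≤ ∫ t, c * ((f t ^ 2 / K + K * u t ^ 2) / 2) := by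
        refine integral_mono_of_nonneg (Eventually.of_forall fun t => ?_) hI
          (Eventually.of_forall fun t => (hle t).trans ?_)
        · exact mul_nonneg (hw t) (norm_nonneg _)
        · refine mul_le_mul_of_nonneg_left ?_ hc
          have : f t ^ 2 / K + K * u t ^ 2 - 2 * (f t * u t) = (f t - K * u t) ^ 2 / K := by
            field_simp
            ring
          have : 0 ≤ (f t - K * u t) ^ 2 / K := by positivity
          linarith
    _ = c * (((∫ t, f t ^ 2) / K + K * ∫ t, u t ^ 2) / 2) := by
        rw [integral_const_mul, integral_div, integral_add (hf.div_const K) (hu.const_mul K),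
          integral_div, integral_const_mul]
    _ ≤ c * (K * (1 + Q) / 2) := by
        refine mul_le_mul_of_nonneg_left ?_ hc
        have h1 : (∫ t, f t ^ 2) / K ≤ K := by
          rw [div_le_iff₀ hK]; nlinarith
        have h2 := mul_le_mul_of_nonneg_left huQ hK.le
        linarith

/-- For `ν > 1` the solution `greenConv ν h` is small at `-∞`, with a bound that is summable
in `ν`. -/
theorem norm_greenConv_le_of_one_lt {ν c Q : ℝ} (hν : 1 < ν) (hc : 0 ≤ c) {h : ℝ → ℂ}
    {u : ℝ → ℝ} (hle : ∀ t, ‖h t‖ ≤ c * (Real.exp t * u t))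
    (hu : Integrable fun t => u t ^ 2) (huQ : ∫ t, u t ^ 2 ≤ Q) (s : ℝ) :
    ‖greenConv ν h s‖ ≤ c * (1 + Q) / 4 * (1 / (ν * √(ν - 1))) * Real.exp s := by
  have hν0 : 0 < ν := by linarith
  have hν1 : 0 < ν - 1 := by linarith
  have hI := integrable_exp_neg_mul_abs (a := 2 * (ν - 1)) (by linarith)
  have hexp : ∀ t, (Real.exp (-(ν - 1) * |t - s| + s)) ^ 2 =
      Real.exp (2 * s) * Real.exp (-(2 * (ν - 1)) * |t - s|) := by
    intro t
    rw [← Real.exp_add, ← Real.exp_nat_mul]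
    congr 1
    push_cast
    ring
  have hs : 0 < √(ν - 1) := Real.sqrt_pos.2 hν1
  -- Since t ≤ s + |t - s|, one unit of the decay rate ν converts the factor e^t into e^s and the
  -- rate ν - 1 remains. The square of this majorant has integral e^{2s}/(ν - 1), whence the choice
  -- of K.
  have := integral_mul_norm_le (w := fun t => Real.exp (-ν * |t - s|))
    (f := fun t => Real.exp (-(ν - 1) * |t - s| + s)) (u := fun t => |u t|) (h := h)
    (K := Real.exp s / √(ν - 1)) (Q := Q) hc (by positivity) (fun t => (Real.exp_pos _).le)
    ?_ ?_ ?_ (by simpa using hu) (by simpa using huQ)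
  · refine (norm_greenConv_le h hν0 s).trans ?_
    calc 1 / (2 * ν) * ∫ t, Real.exp (-ν * |t - s|) * ‖h t‖
        ≤ 1 / (2 * ν) * (c * (Real.exp s / √(ν - 1) * (1 + Q) / 2)) := by gcongr
      _ = _ := by field_simp; ring
  · intro t
    calc Real.exp (-ν * |t - s|) * ‖h t‖
        ≤ Real.exp (-ν * |t - s|) * (c * (Real.exp t * |u t|)) := by
          gcongr
          refine (hle t).trans ?_
          gcongr
          exact le_abs_self _
      _ = c * (Real.exp (-ν * |t - s| + t) * |u t|) := by rw [Real.exp_add]; ring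
      _ ≤ _ := by
          gcongr c * (Real.exp ?_ * _)
          have := le_abs_self (t - s)
          linarith
  · simp only [hexp]
    exact (hI.comp_sub_right s).const_mul _
  · simp only [hexp]
    rw [integral_const_mul, integral_sub_right_eq_self (fun t => Real.exp (-(2 * (ν - 1)) * |t|)),
      integral_exp_neg_mul_abs (by linarith), div_pow, Real.sq_sqrt hν1.le, ← Real.exp_nat_mul]
    refine le_of_eq ?_
    push_cast
    field_simp

/-- For `ν < 1` the solution `greenConv ν h` decays at `-∞` like `exp (ν s)`. -/
theorem exists_norm_greenConv_le_of_lt_one {ν c Q T : ℝ} (hν : 0 < ν) (hν1 : ν < 1) (hc : 0 ≤ c)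
    {h : ℝ → ℂ} {u : ℝ → ℝ} (hle : ∀ t, ‖h t‖ ≤ c * (Real.exp t * u t)) (hT : ∀ t, T < t → h t = 0)
    (hu : Integrable fun t => u t ^ 2) (huQ : ∫ t, u t ^ 2 ≤ Q) :
    ∃ C, ∀ s, ‖greenConv ν h s‖ ≤ C * Real.exp (ν * s) := by
  set J : ℝ := ∫ t in Set.Iic T, Real.exp ((2 - 2 * ν) * t) with hJ
  have hJ0 : 0 < J := by
    rw [hJ, integral_exp_mul_Iic (by linarith)]
    have : 0 < 2 - 2 * ν := by linarith
    positivity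
  refine ⟨1 / (2 * ν) * (c * (√J * (1 + Q) / 2)), fun s => ?_⟩
  -- No decay is left to spare when ν < 1. Instead -ν|t - s| ≤ ν(s - t) extracts e^{νs}, and
  -- e^{(1-ν)t} is square integrable on (-∞, T], where the source lives.
  set f : ℝ → ℝ := (Set.Iic T).indicator fun t => Real.exp (ν * s + (1 - ν) * t) with hf
  have hf2 : (fun t => f t ^ 2) = (Set.Iic T).indicator fun t =>
      Real.exp (2 * ν * s) * Real.exp ((2 - 2 * ν) * t) := by
    funext t
    by_cases ht : t ∈ Set.Iic T
    · rw [hf]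
      simp only [Set.indicator_of_mem ht, ← Real.exp_add, ← Real.exp_nat_mul]
      congr 1
      push_cast
      ring
    · rw [hf]
      simp [Set.indicator_of_notMem ht]
  have hJs := Real.sqrt_pos.2 hJ0
  have := integral_mul_norm_le (w := fun t => Real.exp (-ν * |t - s|))
    (f := f) (u := fun t => |u t|) (h := h)
    (K := Real.exp (ν * s) * √J) (Q := Q) hc (by positivity) (fun t => (Real.exp_pos _).le)
    ?_ ?_ ?_ (by simpa using hu) (by simpa using huQ)
  · refine (norm_greenConv_le h hν s).trans ?_
    calc 1 / (2 * ν) * ∫ t, Real.exp (-ν * |t - s|) * ‖h t‖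
        ≤ 1 / (2 * ν) * (c * (Real.exp (ν * s) * √J * (1 + Q) / 2)) := by gcongr
      _ = _ := by ring
  · intro t
    by_cases ht : t ∈ Set.Iic T
    · rw [hf]
      simp only [Set.indicator_of_mem ht]
      calc Real.exp (-ν * |t - s|) * ‖h t‖
          ≤ Real.exp (-ν * |t - s|) * (c * (Real.exp t * |u t|)) := by
            gcongr
            refine (hle t).trans ?_
            gcongr
            exact le_abs_self _
        _ = c * (Real.exp (-ν * |t - s| + t) * |u t|) := by rw [Real.exp_add]; ring
        _ ≤ _ := by
            gcongr c * (Real.exp ?_ * _)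
            have := mul_le_mul_of_nonneg_left (le_abs_self (t - s)) hν.le
            linarith
    · rw [hT t (not_le.1 ht), hf]
      simp [Set.indicator_of_notMem ht]
  · rw [hf2, integrable_indicator_iff measurableSet_Iic]
    exact (integrableOn_exp_mul_Iic (by linarith) T).const_mul _
  · have e : ∫ t, f t ^ 2 = Real.exp (2 * ν * s) * J := by
      rw [hf2, integral_indicator measurableSet_Iic, integral_const_mul]
    rw [e, mul_pow, Real.sq_sqrt hJ0.le, ← Real.exp_nat_mul]
    push_cast
    rw [mul_assoc]

end AharonovBohm

/-! ### Solutions of the modified Bessel equation in logarithmic coordinates -/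

namespace AharonovBohm

/-- `F` is a weak solution on `(-∞, T)` of the modified Bessel equation `F'' = (ν² - z e^{2t}) F`
in logarithmic coordinates, square integrable with respect to `e^{2t} dt`. -/
structure IsModeSolution (z : ℂ) (T ν Q : ℝ) (F : ℝ → ℂ) : Prop where
  memLp : MemLp (fun t => (Real.exp t : ℂ) * F t) 2 volume
  integral_le : ∫ t, ‖(Real.exp t : ℂ) * F t‖ ^ 2 ≤ Q
  weak : ∀ g ∈ testOn T, ∫ t, F t *
    (deriv (deriv g) t - ν ^ 2 * g t + z * Complex.exp (2 * t) * g t) = 0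

variable {z : ℂ} {T ν Q : ℝ} {F : ℝ → ℂ}

theorem IsModeSolution.nonneg (hF : IsModeSolution z T ν Q F) : 0 ≤ Q :=
  le_trans (integral_nonneg fun t => by positivity) hF.integral_le

theorem IsModeSolution.integrable_sq (hF : IsModeSolution z T ν Q F) :
    Integrable fun t => ‖(Real.exp t : ℂ) * F t‖ ^ 2 :=
  (memLp_two_iff_integrable_sq_norm hF.memLp.1).1 hF.memLp

theorem IsModeSolution.locallyIntegrable (hF : IsModeSolution z T ν Q F) :
    LocallyIntegrable F := by
  have h1 : LocallyIntegrable (fun t => (Real.exp t : ℂ) * F t) :=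
    hF.memLp.locallyIntegrable (by norm_num)
  have h2 := h1.smul_continuous (g := fun t => (Real.exp (-t) : ℂ)) (by fun_prop)
  refine h2.congr (Eventually.of_forall fun t => ?_)
  simp only [smul_eq_mul]
  rw [mul_right_comm, ← Complex.ofReal_mul, ← Real.exp_add]
  simp

/-- The inhomogeneity of the equation, regarded as `F'' - ν² F = h`. -/
noncomputable def modeSource (z : ℂ) (T : ℝ) (F : ℝ → ℂ) : ℝ → ℂ :=
  (Set.Iio T).indicator fun t => -z * Complex.exp (2 * t) * F t

/-- Splitting e^{2t} = e^t · e^t isolates the square integrable factor e^t F in the shape required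
by the Green function bounds. -/
theorem norm_modeSource_le (z : ℂ) (T : ℝ) (F : ℝ → ℂ) (t : ℝ) :
    ‖modeSource z T F t‖ ≤ ‖z‖ * (Real.exp t * ‖(Real.exp t : ℂ) * F t‖) := by
  rw [modeSource]
  refine (norm_indicator_le_norm_self _ _).trans_eq ?_
  rw [show (2 * t : ℂ) = t + t by ring, Complex.exp_add, ← Complex.ofReal_exp]
  simp only [norm_mul, norm_neg, Complex.norm_real, Real.norm_eq_abs, Real.abs_exp]
  ring

theorem modeSource_eq_zero (z : ℂ) {T : ℝ} (F : ℝ → ℂ) {t : ℝ} (ht : T < t) :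
    modeSource z T F t = 0 := by
  rw [modeSource, Set.indicator_of_notMem (by simpa using ht.le)]

/-- Product of two L² functions on (-∞, T), namely -z e^t and e^t F. The cut-off at T is essential,
since e^t is not square integrable on the whole line. -/
theorem IsModeSolution.integrable_modeSource (hF : IsModeSolution z T ν Q F) :
    Integrable (modeSource z T F) := by
  rw [modeSource, integrable_indicator_iff measurableSet_Iio]
  have h1 : MemLp (fun t : ℝ => -z * (Real.exp t : ℂ)) 2 (volume.restrict (Set.Iio T)) := by
    rw [memLp_two_iff_integrable_sq_norm (Continuous.aestronglyMeasurable (by fun_prop))]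
    have h0 : IntegrableOn (fun t => ‖z‖ ^ 2 * Real.exp (2 * t)) (Set.Iio T) :=
      ((integrableOn_exp_mul_Iic (by norm_num) T).mono_set Set.Iio_subset_Iic_self).const_mul _
    refine h0.congr (Eventually.of_forall fun t => ?_)
    simp only [norm_mul, norm_neg, Complex.norm_real, Real.norm_eq_abs, Real.abs_exp, mul_pow]
    rw [← Real.exp_nat_mul]
    norm_num
  have h2 := h1.integrable_mul (hF.memLp.restrict (Set.Iio T))
  refine h2.congr (Eventually.of_forall fun t => ?_)
  simp only [Pi.mul_apply]
  rw [show (2 * t : ℂ) = t + t by ring, Complex.exp_add, ← Complex.ofReal_exp]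
  ring

theorem IsModeSolution.exists_eq (hF : IsModeSolution z T ν Q F) (hν : 0 < ν) :
    ∃ A B : ℂ, ∀ᵐ t : ℝ, t < T → F t =
      A * Complex.exp (ν * t) + B * Complex.exp (-ν * t) + greenConv ν (modeSource z T F) t := by
  refine exists_eq_exp_add_greenConv hν hF.locallyIntegrable hF.integrable_modeSource ?_
  intro g hg
  have hi : ∀ k : ℝ → ℂ, Continuous k → HasCompactSupport k → Integrable fun t => F t * k t := by
    intro k hk hkc
    have := hF.locallyIntegrable.integrable_smul_left_of_hasCompactSupport hk hkc
    exact this.congr (Eventually.of_forall fun t => by simp [mul_comm])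
  have hgd := deriv_mem_testOn (deriv_mem_testOn hg)
  have hgc := continuous_of_mem_testOn hg
  have hgs := hasCompactSupport_of_mem_testOn hg
  have hgdc := continuous_of_mem_testOn hgd
  have i1 : Integrable fun t => F t * (deriv (deriv g) t - ν ^ 2 * g t) :=
    hi _ (by fun_prop) ((hasCompactSupport_of_mem_testOn hgd).sub
      (HasCompactSupport.mul_left (f := fun _ => (ν : ℂ) ^ 2) hgs))
  have i2 : Integrable fun t : ℝ => F t * (z * Complex.exp (2 * t) * g t) :=
    hi _ (by fun_prop) (HasCompactSupport.mul_left
      (f := fun t : ℝ => z * Complex.exp (2 * t)) hgs)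
  have := hF.weak g hg
  simp only [mul_add] at this
  rw [integral_add i1 i2] at this
  rw [eq_neg_of_add_eq_zero_left this, ← integral_neg]
  congr 1
  funext t
  -- The cut-off in the source is invisible to g, which vanishes from T onwards.
  by_cases ht : t < T
  · rw [modeSource, Set.indicator_of_mem (Set.mem_Iio.2 ht)]
    ring
  · have : g t = 0 := by
      obtain ⟨-, a, b, hb, h⟩ := hg
      by_contra h0
      linarith [(h t h0).2]
    simp [this]

theorem norm_cexp_mul (ν t : ℝ) : ‖Complex.exp (ν * t)‖ = Real.exp (ν * t) := by
  rw [Complex.norm_exp]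
  simp

theorem norm_cexp_neg_mul (ν t : ℝ) : ‖Complex.exp (-ν * t)‖ = Real.exp (-ν * t) := by
  rw [Complex.norm_exp]
  simp

/-- The modes with `0 < ν < 1` have a singular term and a remainder that decays. -/
theorem IsModeSolution.exists_norm_sub_le (hF : IsModeSolution z T ν Q F) (hν : 0 < ν)
    (hν1 : ν < 1) : ∃ (B : ℂ) (C : ℝ), ∀ᵐ t : ℝ, t < T →
      ‖F t - B * Complex.exp (-ν * t)‖ ≤ C * Real.exp (ν * t) := by
  obtain ⟨A, B, h⟩ := hF.exists_eq hν
  obtain ⟨C, hC⟩ := exists_norm_greenConv_le_of_lt_one hν hν1 (norm_nonneg z)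
    (norm_modeSource_le z T F) (fun t => modeSource_eq_zero z F) hF.integrable_sq hF.integral_le
  refine ⟨B, ‖A‖ + C, ?_⟩
  filter_upwards [h] with t ht hT
  rw [ht hT, show A * Complex.exp (ν * t) + B * Complex.exp (-ν * t) +
      greenConv ν (modeSource z T F) t - B * Complex.exp (-ν * t) =
      A * Complex.exp (ν * t) + greenConv ν (modeSource z T F) t by ring, add_mul]
  refine (norm_add_le _ _).trans (add_le_add ?_ (hC t))
  rw [norm_mul, norm_cexp_mul]

/-- A half-line has infinite measure, so no nonzero constant is dominated there by a square
integrable function. This excludes the singular exponential in the modes with ν > 1. -/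
theorem eq_zero_of_memLp_of_norm_le {f : ℝ → ℂ} (hf : MemLp f 2 volume) {b C S : ℝ} (hb : 0 ≤ b)
    (h : ∀ᵐ t : ℝ, t < S → b ≤ ‖f t‖ + C * Real.exp (2 * t)) : b = 0 := by
  have h1 : MemLp (fun t => C * Real.exp (2 * t)) 2 (volume.restrict (Set.Iio S)) := by
    rw [memLp_two_iff_integrable_sq_norm (Continuous.aestronglyMeasurable (by fun_prop))]
    have h0 : IntegrableOn (fun t => C ^ 2 * Real.exp (4 * t)) (Set.Iio S) :=
      ((integrableOn_exp_mul_Iic (by norm_num) S).mono_set Set.Iio_subset_Iic_self).const_mul _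
    refine h0.congr (Eventually.of_forall fun t => ?_)
    simp only [Real.norm_eq_abs, sq_abs, mul_pow]
    rw [← Real.exp_nat_mul]
    ring_nf
  have h2 : MemLp (fun _ : ℝ => b) 2 (volume.restrict (Set.Iio S)) := by
    refine ((hf.restrict (Set.Iio S)).norm.add h1).mono' aestronglyMeasurable_const ?_
    rw [ae_restrict_iff' measurableSet_Iio]
    filter_upwards [h] with t ht hS
    rw [Real.norm_of_nonneg hb]
    exact ht hS
  rw [memLp_const_iff (by norm_num) (by norm_num)] at h2
  simpa using h2

/-- The modes with `ν > 1` are regular, with a bound that is summable in `ν`. -/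
theorem IsModeSolution.norm_le (hF : IsModeSolution z T ν Q F) (hν : 1 < ν) :
    ∀ᵐ t : ℝ, t < T - 2 → ‖F t‖ ≤ (‖z‖ * (1 + Q) / 2 * (1 / (ν * √(ν - 1))) +
      Real.exp (2 - 2 * T) * (1 + Q) * Real.exp (-(ν - 1))) * Real.exp t := by
  have hν0 : 0 < ν := by linarith
  obtain ⟨A, B, h⟩ := hF.exists_eq hν0
  set G := greenConv ν (modeSource z T F) with hG
  set D := ‖z‖ * (1 + Q) / 4 * (1 / (ν * √(ν - 1))) with hD
  have hQ := hF.nonneg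
  have hD0 : 0 ≤ D := by positivity
  have hGD : ∀ s, ‖G s‖ ≤ D * Real.exp s := norm_greenConv_le_of_one_lt hν (norm_nonneg z)
    (norm_modeSource_le z T F) hF.integrable_sq hF.integral_le
  -- For t < 0 one has e^t e^{-νt} ≥ 1, so ‖B‖ is at most the norm of e^t F up to the contributions
  -- of the Green term and of A e^{νt}, which after multiplication by e^t are O(e^{2t}).
  have hB : B = 0 := by
    rw [← norm_eq_zero]
    refine eq_zero_of_memLp_of_norm_le hF.memLp (C := D + ‖A‖) (S := min T 0) (norm_nonneg B) ?_
    filter_upwards [h] with t ht hS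
    have ht0 : t < 0 := hS.trans_le (min_le_right _ _)
    have e := ht (hS.trans_le (min_le_left _ _))
    have e1 : (Real.exp t : ℂ) * (B * Complex.exp (-ν * t)) = (Real.exp t : ℂ) * F t -
        ((Real.exp t : ℂ) * G t + (Real.exp t : ℂ) * (A * Complex.exp (ν * t))) := by
      rw [e]; ring
    have e2 := congrArg norm e1
    rw [norm_mul, norm_mul, norm_cexp_neg_mul, Complex.norm_real, Real.norm_eq_abs,
      Real.abs_exp] at e2
    have e3 : Real.exp (2 * t) = Real.exp t * Real.exp t := by rw [← Real.exp_add]; ring_nf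
    have e4 : ‖(Real.exp t : ℂ) * G t‖ ≤ D * Real.exp (2 * t) := by
      rw [norm_mul, Complex.norm_real, Real.norm_eq_abs, Real.abs_exp, e3]
      calc Real.exp t * ‖G t‖ ≤ Real.exp t * (D * Real.exp t) := by gcongr; exact hGD t
        _ = _ := by ring
    have e5 : ‖(Real.exp t : ℂ) * (A * Complex.exp (ν * t))‖ ≤ ‖A‖ * Real.exp (2 * t) := by
      rw [norm_mul, norm_mul, norm_cexp_mul, Complex.norm_real, Real.norm_eq_abs, Real.abs_exp, e3]
      calc Real.exp t * (‖A‖ * Real.exp (ν * t)) ≤ Real.exp t * (‖A‖ * Real.exp t) := by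
            gcongr; nlinarith
        _ = _ := by ring
    have e6 : ‖B‖ ≤ Real.exp t * (‖B‖ * Real.exp (-ν * t)) := by
      have : 1 ≤ Real.exp t * Real.exp (-ν * t) := by
        rw [← Real.exp_add]
        exact Real.one_le_exp (by nlinarith)
      nlinarith [norm_nonneg B]
    have e7 := norm_sub_le ((Real.exp t : ℂ) * F t)
      ((Real.exp t : ℂ) * G t + (Real.exp t : ℂ) * (A * Complex.exp (ν * t)))
    have e8 := norm_add_le ((Real.exp t : ℂ) * G t) ((Real.exp t : ℂ) * (A * Complex.exp (ν * t)))
    rw [add_mul]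
    linarith
  -- To control A, a point t₀ is picked in the unit interval (T - 1, T) at which |e^t F|² does not
  -- exceed its mean, hence is at most Q, and at which the a.e. formula for F holds.
  have hprob : IsProbabilityMeasure (volume.restrict (Set.Ioo (T - 1) T)) :=
    ⟨by simp [Real.volume_Ioo]⟩
  obtain ⟨t₀, ht₀, hle⟩ := exists_notMem_null_le_integral
    (μ := volume.restrict (Set.Ioo (T - 1) T)) (hF.integrable_sq.restrict)
    (ae_iff.1 ((ae_restrict_mem measurableSet_Ioo).and (ae_restrict_of_ae h)))
  simp only [Set.mem_ofPred_eq, not_not] at ht₀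
  obtain ⟨⟨hl, hr⟩, ht₀⟩ := ht₀
  have e0 := ht₀ hr
  rw [hB, zero_mul, add_zero] at e0
  have hle2 : ‖(Real.exp t₀ : ℂ) * F t₀‖ ^ 2 ≤ Q := hle.trans
    ((setIntegral_le_integral hF.integrable_sq
      (Eventually.of_forall fun t => by positivity)).trans hF.integral_le)
  have hle3 : ‖F t₀‖ ≤ Real.exp (-t₀) * (1 + Q) := by
    have e1 : ‖(Real.exp t₀ : ℂ) * F t₀‖ ≤ 1 + Q := by
      nlinarith [norm_nonneg ((Real.exp t₀ : ℂ) * F t₀)]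
    rw [norm_mul, Complex.norm_real, Real.norm_eq_abs, Real.abs_exp] at e1
    calc ‖F t₀‖ = Real.exp (-t₀) * (Real.exp t₀ * ‖F t₀‖) := by
          rw [← mul_assoc, ← Real.exp_add]; simp
      _ ≤ _ := by gcongr
  have hA : ‖A‖ * Real.exp (ν * t₀) ≤ Real.exp (-t₀) * (1 + Q) + D * Real.exp t₀ := by
    rw [← norm_cexp_mul, ← norm_mul,
      show A * Complex.exp (ν * t₀) = F t₀ - G t₀ by rw [e0]; ring]
    exact (norm_sub_le _ _).trans (add_le_add hle3 (hGD t₀))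
  filter_upwards [h] with t ht hT
  have e := ht (by linarith)
  rw [hB, zero_mul, add_zero] at e
  have hAt : ‖A‖ * Real.exp (ν * t) ≤
      (D + Real.exp (2 - 2 * T) * (1 + Q) * Real.exp (-(ν - 1))) * Real.exp t := by
    -- Here t < T - 2 and t₀ > T - 1, so t - t₀ < -1. This margin produces the factor e^{-(ν-1)},
    -- which makes the contribution of A summable over the modes.
    have e1 : Real.exp (ν * (t - t₀)) ≤ Real.exp (-(ν - 1)) * Real.exp (t - t₀) := by
      rw [← Real.exp_add]
      exact Real.exp_le_exp.2 (by nlinarith)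
    have e2 : Real.exp (-(ν - 1)) ≤ 1 := Real.exp_le_one_iff.2 (by linarith)
    have e3 : Real.exp (t - t₀) * Real.exp t₀ = Real.exp t := by rw [← Real.exp_add]; ring_nf
    have e4 : Real.exp (t - t₀) * Real.exp (-t₀) ≤ Real.exp (2 - 2 * T) * Real.exp t := by
      rw [← Real.exp_add, ← Real.exp_add]
      exact Real.exp_le_exp.2 (by linarith)
    calc ‖A‖ * Real.exp (ν * t) = Real.exp (ν * (t - t₀)) * (‖A‖ * Real.exp (ν * t₀)) := by
          rw [mul_left_comm, ← Real.exp_add]; ring_nf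
      _ ≤ (Real.exp (-(ν - 1)) * Real.exp (t - t₀)) *
          (Real.exp (-t₀) * (1 + Q) + D * Real.exp t₀) := by gcongr
      _ = Real.exp (-(ν - 1)) * (D * Real.exp t) +
          Real.exp (-(ν - 1)) * (1 + Q) * (Real.exp (t - t₀) * Real.exp (-t₀)) := by
          rw [← e3]; ring
      _ ≤ 1 * (D * Real.exp t) +
          Real.exp (-(ν - 1)) * (1 + Q) * (Real.exp (2 - 2 * T) * Real.exp t) := by gcongr
      _ = _ := by ring
  calc ‖F t‖ ≤ ‖A * Complex.exp (ν * t)‖ + ‖G t‖ := by rw [e]; exact norm_add_le _ _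
    _ ≤ (D + Real.exp (2 - 2 * T) * (1 + Q) * Real.exp (-(ν - 1))) * Real.exp t +
        D * Real.exp t := by
        rw [norm_mul, norm_cexp_mul]
        exact add_le_add hAt (hGD t)
    _ = _ := by rw [hD]; ring

end AharonovBohm

/-! ### Logarithmic polar coordinates and Fourier series -/

namespace AharonovBohm

/-- Logarithmic polar coordinates on the punctured plane. -/
noncomputable def expMap (p : ℝ × ℝ) : ℂ := Complex.exp (p.1 + p.2 * Complex.I)

/-- The measure `dt dθ` on `ℝ × (-π, π]`. -/
noncomputable def stripMeasure : Measure (ℝ × ℝ) :=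
  (volume : Measure ℝ).prod (volume.restrict (Set.Ioc (-Real.pi) Real.pi))

theorem stripMeasure_eq : stripMeasure =
    volume.restrict (Set.univ ×ˢ Set.Ioc (-Real.pi) Real.pi) := by
  rw [stripMeasure, Measure.volume_eq_prod, ← Measure.prod_restrict, Measure.restrict_univ]

instance : SFinite stripMeasure := by unfold stripMeasure; infer_instance

/-- The real determinant of multiplication by c is the norm of c for the extension ℂ/ℝ. With c = e^w
it is the Jacobian of the exponential. -/
theorem det_mul_complex (c : ℂ) :
    ((ContinuousLinearMap.toSpanSingleton ℂ c).restrictScalars ℝ : ℂ →L[ℝ] ℂ).det = ‖c‖ ^ 2 := by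
  rw [← Complex.normSq_eq_norm_sq, ← Algebra.norm_complex_apply, Algebra.norm_apply]
  rw [ContinuousLinearMap.det]
  congr 1
  ext x
  simp [mul_comm]

theorem measurable_expMap : Measurable expMap := by
  unfold expMap
  fun_prop

/-- Change of variables for the complex exponential: it is injective on the strip -π < Im w ≤ π, its
image misses only the null set {0}, and its Jacobian is |e^w|² = e^{2t}. -/
theorem map_expMap : Measure.map expMap
    (stripMeasure.withDensity fun p => ENNReal.ofReal (Real.exp (2 * p.1))) = volume := by
  set s : Set ℂ := {w | w.im ∈ Set.Ioc (-Real.pi) Real.pi} with hs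
  have hsm : MeasurableSet s := measurableSet_Ioc.preimage Complex.measurable_im
  have himg : Complex.exp '' s = {0}ᶜ := by
    ext x
    constructor
    · rintro ⟨w, -, rfl⟩
      exact Complex.exp_ne_zero w
    · intro hx
      exact ⟨Complex.log x, ⟨Complex.neg_pi_lt_log_im x, Complex.log_im_le_pi x⟩,
        Complex.exp_log hx⟩
  have hinj : Set.InjOn Complex.exp s := fun x hx y hy hxy =>
    Complex.exp_inj_of_neg_pi_lt_of_le_pi hx.1 hx.2 hy.1 hy.2 hxy
  have h1 := map_withDensity_abs_det_fderiv_eq_addHaar (μ := (volume : Measure ℂ))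
    hsm.nullMeasurableSet (f := Complex.exp)
    (f' := fun w => (ContinuousLinearMap.toSpanSingleton ℂ (Complex.exp w)).restrictScalars ℝ)
    (fun w _ => ((Complex.hasDerivAt_exp w).hasFDerivAt.restrictScalars ℝ).hasFDerivWithinAt) hinj
  have h2 : (volume : Measure ℂ).restrict {0}ᶜ = volume := by
    rw [Measure.restrict_eq_self_of_ae_mem]
    exact compl_mem_ae_iff.2 (by simp)
  rw [himg, h2] at h1
  conv_rhs => rw [← h1]
  have hmp := Complex.volume_preserving_equiv_real_prod.symm
  have hcomp : expMap = Complex.exp ∘ Complex.measurableEquivRealProd.symm := by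
    funext p
    simp only [expMap, Function.comp_apply]
    congr 1
    apply Complex.ext <;> simp [Complex.measurableEquivRealProd]
  have hmap : Measure.map Complex.measurableEquivRealProd.symm
      (stripMeasure.withDensity fun p => ENNReal.ofReal (Real.exp (2 * p.1))) =
      (volume.restrict s).withDensity fun w => ENNReal.ofReal
        |((ContinuousLinearMap.toSpanSingleton ℂ (Complex.exp w)).restrictScalars ℝ :
          ℂ →L[ℝ] ℂ).det| := by
    ext t ht
    have hpre : MeasurableSet (Complex.measurableEquivRealProd.symm ⁻¹' t) :=
      Complex.measurableEquivRealProd.symm.measurable ht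
    rw [Measure.map_apply Complex.measurableEquivRealProd.symm.measurable ht,
      withDensity_apply _ hpre, withDensity_apply _ ht, stripMeasure_eq,
      Measure.restrict_restrict hpre, Measure.restrict_restrict ht,
      ← hmp.setLIntegral_comp_preimage_emb Complex.measurableEquivRealProd.symm.measurableEmbedding]
    congr 1
    · congr 1
      ext p
      simp [hs, Complex.measurableEquivRealProd]
    · funext p
      rw [det_mul_complex, Complex.norm_exp, abs_of_nonneg (by positivity), ← Real.exp_nat_mul]
      simp [Complex.measurableEquivRealProd]
  rw [hcomp, ← Measure.map_map Complex.measurable_exp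
    Complex.measurableEquivRealProd.symm.measurable, hmap]

theorem integrable_iff_expMap {E : Type*} [NormedAddCommGroup E] [NormedSpace ℝ E] {f : ℂ → E}
    (hf : AEStronglyMeasurable f volume) :
    Integrable f ↔ Integrable (fun p => Real.exp (2 * p.1) • f (expMap p)) stripMeasure := by
  conv_lhs => rw [← map_expMap]
  rw [integrable_map_measure (by rwa [map_expMap]) measurable_expMap.aemeasurable,
    integrable_withDensity_iff_integrable_smul' (by fun_prop) (by simp)]
  refine integrable_congr (Eventually.of_forall fun p => ?_)
  simp [ENNReal.toReal_ofReal (Real.exp_pos _).le]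

theorem integral_eq_expMap {E : Type*} [NormedAddCommGroup E] [NormedSpace ℝ E] {f : ℂ → E}
    (hf : AEStronglyMeasurable f volume) :
    ∫ x, f x = ∫ p, Real.exp (2 * p.1) • f (expMap p) ∂stripMeasure := by
  conv_lhs => rw [← map_expMap]
  rw [integral_map measurable_expMap.aemeasurable (by rwa [map_expMap]),
    integral_withDensity_eq_integral_toReal_smul (by fun_prop) (by simp)]
  refine integral_congr_ae (Eventually.of_forall fun p => ?_)
  simp [ENNReal.toReal_ofReal (Real.exp_pos _).le]

/-- Fubini for null sets. Of the density e^{2t}, only the absolute continuity matters. -/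
theorem ae_of_ae_ae_expMap {P : ℂ → Prop} (hP : MeasurableSet {x | P x})
    (h : ∀ᵐ t : ℝ, ∀ᵐ θ ∂volume.restrict (Set.Ioc (-Real.pi) Real.pi), P (expMap (t, θ))) :
    ∀ᵐ x : ℂ, P x := by
  rw [← map_expMap, ae_map_iff measurable_expMap.aemeasurable hP]
  refine withDensity_absolutelyContinuous stripMeasure _ ?_
  exact (Measure.ae_prod_iff_ae_ae (p := fun p => P (expMap p)) (measurable_expMap hP)).2 h

theorem norm_expMap (p : ℝ × ℝ) : ‖expMap p‖ = Real.exp p.1 := by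
  rw [expMap, Complex.norm_exp]
  simp

theorem arg_expMap {p : ℝ × ℝ} (hp : p.2 ∈ Set.Ioc (-Real.pi) Real.pi) :
    Complex.arg (expMap p) = p.2 := by
  rw [← Complex.log_im, expMap, Complex.log_exp] <;> simp [hp.1, hp.2]

theorem ae_stripMeasure_mem :
    ∀ᵐ p ∂stripMeasure, p.2 ∈ Set.Ioc (-Real.pi) Real.pi := by
  rw [stripMeasure_eq]
  filter_upwards [ae_restrict_mem (MeasurableSet.univ.prod measurableSet_Ioc)] with p hp using hp.2

/-- A square integrable function whose Fourier coefficients are bounded by a summable sequence is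
bounded by the sum. -/
theorem ae_norm_le_tsum_of_fourierCoeffOn {a b : ℝ} (hab : a < b) {f : ℝ → ℂ}
    (hf : MemLp f 2 (volume.restrict (Set.Ioc a b))) {d : ℤ → ℝ} (hd : Summable d)
    (hle : ∀ m, ‖fourierCoeffOn hab f m‖ ≤ d m) :
    ∀ᵐ θ ∂volume.restrict (Set.Ioc a b), ‖f θ‖ ≤ ∑' m, d m := by
  have := Fact.mk (by linarith : 0 < b - a)
  rw [← add_sub_cancel a b] at hf
  have h := hf.memLp_liftIoc.haarAddCircle
  set H := AddCircle.liftIoc (b - a) a f with hH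
  have hc : ∀ m, fourierCoeff (h.toLp : AddCircle (b - a) → ℂ) m = fourierCoeffOn hab f m := by
    intro m
    rw [fourierCoeff_congr_ae h.coeFn_toLp]
    rfl
  have hle' : ∀ m, ‖fourierCoeffOn hab f m • (fourier m : C(AddCircle (b - a), ℂ))‖ ≤ d m := by
    intro m
    rw [norm_smul, fourier_norm, mul_one]
    exact hle m
  have hsum : Summable fun m => fourierCoeffOn hab f m • (fourier m : C(AddCircle (b - a), ℂ)) :=
    Summable.of_norm_bounded hd hle'
  set s := ∑' m, fourierCoeffOn hab f m • (fourier m : C(AddCircle (b - a), ℂ)) with hs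
  have hsn : ‖s‖ ≤ ∑' m, d m := tsum_of_norm_bounded hd.hasSum hle'
  have h1 := hasSum_fourier_series_L2 h.toLp
  simp only [hc] at h1
  have h2 := (ContinuousMap.toLp 2 (AddCircle.haarAddCircle (T := b - a)) ℂ (E := ℂ)).hasSum
    hsum.hasSum
  simp only [map_smul] at h2
  -- The Fourier series converges in L² to the function and, being absolutely summable, also
  -- uniformly to a continuous s; uniqueness of the L² limit identifies the two.
  have h3 : h.toLp = ContinuousMap.toLp 2 AddCircle.haarAddCircle ℂ s := h1.unique h2
  have h4 : H =ᵐ[AddCircle.haarAddCircle] s :=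
    h.coeFn_toLp.symm.trans (h3 ▸ ContinuousMap.coeFn_toLp _ _)
  have h5 : ∀ᵐ y ∂(volume : Measure (AddCircle (b - a))), H y = s y := by
    rw [AddCircle.volume_eq_smul_haarAddCircle]
    exact Measure.ae_smul_measure h4 _
  have h6 := (AddCircle.measurePreserving_mk (b - a) a).quasiMeasurePreserving.ae h5
  rw [add_sub_cancel] at h6
  filter_upwards [h6, ae_restrict_mem measurableSet_Ioc] with θ hθ hm
  rw [hH, AddCircle.liftIoc_coe_apply (by rwa [add_sub_cancel])] at hθ
  rw [hθ]
  exact (s.norm_coe_le_norm _).trans hsn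

end AharonovBohm

/-! ### The angular modes of a weak solution -/

namespace AharonovBohm

/-- The gauge transformed function `e^{-iαθ} ψ` in logarithmic polar coordinates. -/
noncomputable def polarFun (α : ℝ) (ψ : ℂ → ℂ) (t θ : ℝ) : ℂ :=
  Complex.exp (-Complex.I * (α * θ)) * ψ (expMap (t, θ))

/-- The angular Fourier coefficients of `e^{-iαθ} ψ`. -/
noncomputable def angularMode (α : ℝ) (ψ : ℂ → ℂ) (m : ℤ) (t : ℝ) : ℂ :=
  fourierCoeffOn (neg_lt_self Real.pi_pos) (polarFun α ψ t) m

/-- The operator `d²/dt² - ν² + z e^{2t}`. -/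
noncomputable def modeOp (z ν : ℂ) (g : ℝ → ℂ) (t : ℝ) : ℂ :=
  deriv (deriv g) t - ν ^ 2 * g t + z * Complex.exp (2 * t) * g t

/-- The equation `-Δψ = zψ` near `0`, tested against products of radial functions and angular
exponentials with the boundary condition of the Aharonov-Bohm flux `α`. -/
def IsRadialWeakSolution (z : ℂ) (T α : ℝ) (ψ : ℂ → ℂ) : Prop :=
  ∀ m : ℤ, ∀ g ∈ testOn T, ∫ x, ψ x * (Complex.exp (-Complex.I * ((m + α) * Complex.arg x)) *
    ((‖x‖ : ℂ) ^ 2)⁻¹ * modeOp z (m + α) g (Real.log ‖x‖)) = 0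

variable {α : ℝ} {ψ : ℂ → ℂ}

theorem norm_cexp_neg_I_mul (s : ℝ) : ‖Complex.exp (-Complex.I * s)‖ = 1 := by
  rw [Complex.norm_exp]
  simp

theorem norm_polarFun (α : ℝ) (ψ : ℂ → ℂ) (t θ : ℝ) :
    ‖polarFun α ψ t θ‖ = ‖ψ (expMap (t, θ))‖ := by
  rw [polarFun, norm_mul, ← Complex.ofReal_mul, norm_cexp_neg_I_mul, one_mul]

theorem stronglyMeasurable_polarFun (α : ℝ) (hψ : StronglyMeasurable ψ) :
    StronglyMeasurable fun p : ℝ × ℝ => polarFun α ψ p.1 p.2 :=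
  (Continuous.stronglyMeasurable (by fun_prop)).mul (hψ.comp_measurable measurable_expMap)

theorem fourier_neg_coe (m : ℤ) (θ : ℝ) :
    (fourier (-m) (θ : AddCircle (Real.pi - -Real.pi)) : ℂ) =
      Complex.exp (-Complex.I * (m * θ)) := by
  rw [fourier_coe_apply]
  congr 1
  have : (Real.pi : ℂ) ≠ 0 := by exact_mod_cast Real.pi_ne_zero
  push_cast
  rw [sub_neg_eq_add, ← two_mul]
  field_simp

theorem angularMode_eq (α : ℝ) (ψ : ℂ → ℂ) (m : ℤ) (t : ℝ) :
    angularMode α ψ m t = (1 / (2 * Real.pi) : ℝ) *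
      ∫ θ in Set.Ioc (-Real.pi) Real.pi, Complex.exp (-Complex.I * (m * θ)) * polarFun α ψ t θ := by
  rw [angularMode, fourierCoeffOn_eq_integral,
    intervalIntegral.integral_of_le (neg_le_self Real.pi_pos.le), Complex.real_smul]
  simp only [fourier_neg_coe, smul_eq_mul]
  rw [sub_neg_eq_add, ← two_mul]

theorem stronglyMeasurable_angularMode (α : ℝ) (hψ : StronglyMeasurable ψ) (m : ℤ) :
    StronglyMeasurable (angularMode α ψ m) := by
  have : angularMode α ψ m = fun t => ((1 / (2 * Real.pi) : ℝ) : ℂ) *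
      ∫ θ in Set.Ioc (-Real.pi) Real.pi, Complex.exp (-Complex.I * (m * θ)) * polarFun α ψ t θ :=
    funext fun t => angularMode_eq α ψ m t
  rw [this]
  refine stronglyMeasurable_const.mul ?_
  refine StronglyMeasurable.integral_prod_right
    (f := fun t θ : ℝ => Complex.exp (-Complex.I * (m * θ)) * polarFun α ψ t θ) ?_
  exact (Continuous.stronglyMeasurable
    (f := fun p : ℝ × ℝ => Complex.exp (-Complex.I * (m * p.2))) (by fun_prop)).mul
    (stronglyMeasurable_polarFun α hψ)

theorem integrable_strip_sq (hψ : StronglyMeasurable ψ) (h2 : MemLp ψ 2 volume) :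
    Integrable (fun p => Real.exp (2 * p.1) * ‖ψ (expMap p)‖ ^ 2) stripMeasure :=
  (integrable_iff_expMap (f := fun x => ‖ψ x‖ ^ 2)
    (hψ.norm.pow 2).aestronglyMeasurable).1
    ((memLp_two_iff_integrable_sq_norm h2.1).1 h2)

theorem integral_strip_sq (hψ : StronglyMeasurable ψ) :
    ∫ p, Real.exp (2 * p.1) * ‖ψ (expMap p)‖ ^ 2 ∂stripMeasure = ∫ x, ‖ψ x‖ ^ 2 :=
  (integral_eq_expMap (f := fun x => ‖ψ x‖ ^ 2) (hψ.norm.pow 2).aestronglyMeasurable).symm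

theorem ae_memLp_polarFun (α : ℝ) (hψ : StronglyMeasurable ψ) (h2 : MemLp ψ 2 volume) :
    ∀ᵐ t : ℝ, MemLp (polarFun α ψ t) 2 (volume.restrict (Set.Ioc (-Real.pi) Real.pi)) := by
  have h := (integrable_strip_sq hψ h2)
  rw [stripMeasure] at h
  filter_upwards [h.prod_right_ae] with t ht
  have hm : StronglyMeasurable fun θ : ℝ => polarFun α ψ t θ :=
    (Continuous.stronglyMeasurable (f := fun θ : ℝ => Complex.exp (-Complex.I * (α * θ)))
      (by fun_prop)).mul (hψ.comp_measurable (measurable_expMap.comp measurable_prodMk_left))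
  rw [memLp_two_iff_integrable_sq_norm hm.aestronglyMeasurable]
  simp only [norm_polarFun]
  have h1 : ∀ θ : ℝ, ‖ψ (expMap (t, θ))‖ ^ 2 =
      Real.exp (-(2 * t)) * (Real.exp (2 * t) * ‖ψ (expMap (t, θ))‖ ^ 2) := by
    intro θ
    rw [← mul_assoc, ← Real.exp_add]
    simp
  rw [funext h1]
  exact ht.const_mul (Real.exp (-(2 * t)))

/-- Parseval's identity, keeping a single term of the sum. The right side does not depend on m,
which later gives one constant Q for all modes. -/
theorem norm_angularMode_sq_le {t : ℝ}
    (ht : MemLp (polarFun α ψ t) 2 (volume.restrict (Set.Ioc (-Real.pi) Real.pi))) (m : ℤ) :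
    ‖angularMode α ψ m t‖ ^ 2 ≤ (2 * Real.pi)⁻¹ *
      ∫ θ in Set.Ioc (-Real.pi) Real.pi, ‖ψ (expMap (t, θ))‖ ^ 2 := by
  have h := hasSum_sq_fourierCoeffOn (neg_lt_self Real.pi_pos) ht
  have h1 := le_hasSum h m fun j _ => by positivity
  rw [sub_neg_eq_add, ← two_mul, smul_eq_mul,
    intervalIntegral.integral_of_le (neg_le_self Real.pi_pos.le)] at h1
  simp only [norm_polarFun] at h1
  exact h1

/-- A continuous compactly supported radial function times an angular exponential can be
integrated against `e^{-iαθ}ψ` mode by mode. -/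
theorem integral_strip_mul_eq (α : ℝ) (hψ : StronglyMeasurable ψ) (h2 : MemLp ψ 2 volume) (m : ℤ)
    {k : ℝ → ℂ} (hk : Continuous k) (hkc : HasCompactSupport k) :
    ∫ p, k p.1 * (Complex.exp (-Complex.I * (m * p.2)) * polarFun α ψ p.1 p.2) ∂stripMeasure =
      2 * Real.pi * ∫ t, angularMode α ψ m t * k t := by
  have hint : Integrable (fun p : ℝ × ℝ =>
      k p.1 * (Complex.exp (-Complex.I * (m * p.2)) * polarFun α ψ p.1 p.2)) stripMeasure := by
    have hsm := stronglyMeasurable_polarFun α hψ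
    -- Square integrability of ψ is that of e^t ψ(e^{t+iθ}) with respect to dt dθ. The compensating
    -- factor e^{-t} is harmless because k has compact support.
    have m1 : MemLp (fun p : ℝ × ℝ => (Real.exp p.1 : ℂ) *
        (Complex.exp (-Complex.I * (m * p.2)) * polarFun α ψ p.1 p.2)) 2 stripMeasure := by
      have hm : AEStronglyMeasurable (fun p : ℝ × ℝ => (Real.exp p.1 : ℂ) *
          (Complex.exp (-Complex.I * (m * p.2)) * polarFun α ψ p.1 p.2)) stripMeasure :=
        ((Continuous.aestronglyMeasurable (f := fun p : ℝ × ℝ => (Real.exp p.1 : ℂ))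
          (by fun_prop)).mul ((Continuous.aestronglyMeasurable
            (f := fun p : ℝ × ℝ => Complex.exp (-Complex.I * (m * p.2))) (by fun_prop)).mul
              hsm.aestronglyMeasurable))
      rw [memLp_two_iff_integrable_sq_norm hm]
      refine (integrable_strip_sq hψ h2).congr (Eventually.of_forall fun p => ?_)
      simp only [norm_mul, norm_polarFun, Complex.norm_real, Real.norm_eq_abs, Real.abs_exp]
      rw [show (m : ℂ) * p.2 = ((m * p.2 : ℝ) : ℂ) by push_cast; ring, norm_cexp_neg_I_mul,
        one_mul, mul_pow, ← Real.exp_nat_mul]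
      norm_num
    have m2 : MemLp (fun p : ℝ × ℝ => (Real.exp (-p.1) : ℂ) * k p.1) 2 stripMeasure := by
      rw [memLp_two_iff_integrable_sq_norm (Continuous.aestronglyMeasurable (by fun_prop))]
      have i1 : Integrable fun t : ℝ => ‖(Real.exp (-t) : ℂ) * k t‖ ^ 2 :=
        Continuous.integrable_of_hasCompactSupport (by fun_prop)
          ((hkc.mul_left (f := fun t : ℝ => (Real.exp (-t) : ℂ))).comp_left
            (g := fun w : ℂ => ‖w‖ ^ 2) (by simp))
      have i2 : Integrable (fun _ : ℝ => (1 : ℝ))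
          (volume.restrict (Set.Ioc (-Real.pi) Real.pi)) := integrable_const _
      rw [stripMeasure]
      simpa only [mul_one] using i1.mul_prod i2
    refine (m1.integrable_mul m2).congr (Eventually.of_forall fun p => ?_)
    simp only [Pi.mul_apply]
    have : (Real.exp p.1 : ℂ) * (Real.exp (-p.1) : ℂ) = 1 := by
      rw [← Complex.ofReal_mul, ← Real.exp_add]; simp
    linear_combination k p.1 * (Complex.exp (-Complex.I * (m * p.2)) * polarFun α ψ p.1 p.2) * this
  rw [stripMeasure] at hint ⊢
  rw [integral_prod _ hint, ← integral_const_mul]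
  congr 1
  funext t
  simp only
  rw [integral_const_mul, angularMode_eq]
  have : (Real.pi : ℂ) ≠ 0 := by exact_mod_cast Real.pi_ne_zero
  push_cast
  field_simp

theorem continuous_modeOp (z ν : ℂ) {T : ℝ} {g : ℝ → ℂ} (hg : g ∈ testOn T) :
    Continuous (modeOp z ν g) := by
  have h1 := continuous_of_mem_testOn hg
  have h2 := continuous_of_mem_testOn (deriv_mem_testOn (deriv_mem_testOn hg))
  unfold modeOp
  fun_prop

theorem hasCompactSupport_modeOp (z ν : ℂ) {T : ℝ} {g : ℝ → ℂ} (hg : g ∈ testOn T) :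
    HasCompactSupport (modeOp z ν g) := by
  have h1 := hasCompactSupport_of_mem_testOn hg
  have h2 := hasCompactSupport_of_mem_testOn (deriv_mem_testOn (deriv_mem_testOn hg))
  exact (h2.sub (h1.mul_left (f := fun _ => ν ^ 2))).add
    (h1.mul_left (f := fun t : ℝ => z * Complex.exp (2 * t)))

/-- Integrating the Parseval bound over t gives Q independent of m. In the weak equation the
Jacobian e^{2t} cancels the weight |x|^{-2}, and m + α may be replaced by its absolute value because
only its square occurs. -/
theorem isModeSolution_angularMode {z : ℂ} {T : ℝ} (hψ : StronglyMeasurable ψ)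
    (h2 : MemLp ψ 2 volume) (hw : IsRadialWeakSolution z T α ψ) (m : ℤ) :
    IsModeSolution z T |m + α| ((2 * Real.pi)⁻¹ * ∫ x, ‖ψ x‖ ^ 2) (angularMode α ψ m) := by
  have hm : AEStronglyMeasurable (fun t => (Real.exp t : ℂ) * angularMode α ψ m t) volume :=
    (Continuous.aestronglyMeasurable (by fun_prop)).mul
      (stronglyMeasurable_angularMode α hψ m).aestronglyMeasurable
  have hJ := integrable_strip_sq hψ h2
  rw [stripMeasure] at hJ
  have hJ1 := hJ.integral_prod_left.const_mul (2 * Real.pi)⁻¹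
  have hle : ∀ᵐ t : ℝ, ‖(Real.exp t : ℂ) * angularMode α ψ m t‖ ^ 2 ≤ (2 * Real.pi)⁻¹ *
      ∫ θ in Set.Ioc (-Real.pi) Real.pi, Real.exp (2 * t) * ‖ψ (expMap (t, θ))‖ ^ 2 := by
    filter_upwards [ae_memLp_polarFun α hψ h2] with t ht
    have := norm_angularMode_sq_le ht m
    rw [norm_mul, Complex.norm_real, Real.norm_eq_abs, Real.abs_exp, mul_pow, ← Real.exp_nat_mul,
      integral_const_mul]
    push_cast
    rw [mul_left_comm]
    exact mul_le_mul_of_nonneg_left this (Real.exp_pos _).le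
  have hint : Integrable fun t => ‖(Real.exp t : ℂ) * angularMode α ψ m t‖ ^ 2 := by
    refine hJ1.mono' (hm.norm.pow 2) ?_
    filter_upwards [hle] with t ht
    rw [Real.norm_of_nonneg (by positivity)]
    exact ht
  refine ⟨(memLp_two_iff_integrable_sq_norm hm).2 hint, ?_, fun g hg => ?_⟩
  · refine (integral_mono_ae hint hJ1 hle).trans_eq ?_
    rw [integral_const_mul, ← integral_prod _ hJ, ← stripMeasure, integral_strip_sq hψ]
  · have hν : (((|m + α| : ℝ) : ℂ)) ^ 2 = (m + α : ℂ) ^ 2 := by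
      rw [← Complex.ofReal_pow, sq_abs]; push_cast; ring
    have h0 := hw m g hg
    have hkc := continuous_modeOp z (m + α) hg
    have h1 := integral_strip_mul_eq α hψ h2 m hkc (hasCompactSupport_modeOp z (m + α) hg)
    rw [integral_eq_expMap] at h0
    · have h3 : ∫ p, modeOp z (m + α) g p.1 * (Complex.exp (-Complex.I * (m * p.2)) *
          polarFun α ψ p.1 p.2) ∂stripMeasure = 0 := by
        rw [← h0]
        refine integral_congr_ae ?_
        filter_upwards [ae_stripMeasure_mem] with p hp
        rw [arg_expMap hp, norm_expMap, Real.log_exp, polarFun, Complex.real_smul]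
        have e1 : (Real.exp (2 * p.1) : ℂ) * ((Real.exp p.1 : ℂ) ^ 2)⁻¹ = 1 := by
          rw [← Complex.ofReal_pow, ← Real.exp_nat_mul]
          push_cast
          exact mul_inv_cancel₀ (Complex.exp_ne_zero _)
        have e2 : Complex.exp (-Complex.I * ((m + α) * p.2)) =
            Complex.exp (-Complex.I * (m * p.2)) * Complex.exp (-Complex.I * (α * p.2)) := by
          rw [← Complex.exp_add]; ring_nf
        rw [e2]
        linear_combination (-(ψ (expMap p) * modeOp z (m + α) g p.1 *
          Complex.exp (-Complex.I * (m * p.2)) * Complex.exp (-Complex.I * (α * p.2)))) * e1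
      rw [h3] at h1
      have hpi : (2 * Real.pi : ℂ) ≠ 0 := by
        exact_mod_cast mul_ne_zero two_ne_zero Real.pi_ne_zero
      have h4 := (mul_eq_zero.1 h1.symm).resolve_left hpi
      rw [← h4]
      congr 1
      funext t
      rw [hν]
      rfl
    · refine (hψ.mul (Measurable.stronglyMeasurable ?_)).aestronglyMeasurable
      have := hkc.measurable
      have := Complex.measurable_arg
      fun_prop

end AharonovBohm

/-! ### The expansion at a vortex -/

namespace AharonovBohm

variable {α : ℝ} {ψ : ℂ → ℂ}

theorem fourierCoeffOn_fourier {a b : ℝ} (hab : a < b) (n m : ℤ) :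
    fourierCoeffOn hab (fun θ => (fourier n (θ : AddCircle (b - a)) : ℂ)) m =
      if m = n then 1 else 0 := by
  have := Fact.mk (by linarith : 0 < b - a)
  have h := fourierCoeff_eq_intervalIntegral (fourier n : C(AddCircle (b - a), ℂ)) m a
  rw [add_sub_cancel] at h
  rw [fourierCoeffOn_eq_integral, ← h, fourierCoeff_fourier, Pi.single_apply]

theorem fourierCoeffOn_sub_const_mul_fourier {a b : ℝ} (hab : a < b) {f : ℝ → ℂ}
    (hf : IntegrableOn f (Set.Ioc a b)) (c : ℂ) (n m : ℤ) :
    fourierCoeffOn hab (fun θ => f θ - c * (fourier n (θ : AddCircle (b - a)) : ℂ)) m =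
      fourierCoeffOn hab f m - if m = n then c else 0 := by
  have hc : ∀ k : ℤ, Continuous fun θ : ℝ => (fourier k (θ : AddCircle (b - a)) : ℂ) := fun k =>
    (fourier k : C(AddCircle (b - a), ℂ)).continuous.comp (AddCircle.continuous_mk' _)
  have := Fact.mk (by linarith : 0 < b - a)
  have e1 := fourierCoeffOn.const_mul (fun θ => (fourier n (θ : AddCircle (b - a)) : ℂ)) c m hab
  rw [fourierCoeffOn_fourier, mul_ite, mul_one, mul_zero] at e1
  rw [← e1]
  simp only [fourierCoeffOn_eq_integral, smul_eq_mul, mul_sub]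
  rw [← smul_sub, intervalIntegral.integral_sub]
  · rw [intervalIntegrable_iff_integrableOn_Ioc_of_le hab.le]
    refine hf.bdd_mul (c := 1) (hc _).aestronglyMeasurable (Eventually.of_forall fun θ => ?_)
    exact ((fourier (-m) : C(AddCircle (b - a), ℂ)).norm_coe_le_norm _).trans_eq (fourier_norm _)
  · exact ((hc _).mul (continuous_const.mul (hc _))).intervalIntegrable _ _

/-- Both y and √y are at most e^{y/2}. This brings the exponential term of `IsModeSolution.norm_le`
to the same power y^{-3/2} as the Green term. -/
theorem exp_neg_le_inv_mul_sqrt {y : ℝ} (hy : 0 < y) : Real.exp (-y) ≤ 1 / (y * √y) := by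
  have h1 : y ≤ Real.exp (y / 2) := by
    have := Real.quadratic_le_exp_of_nonneg (x := y / 2) (by linarith)
    nlinarith [sq_nonneg (y - 2)]
  have h2 : √y ≤ Real.exp (y / 2) := by
    have h3 := Real.add_one_le_exp (y / 2)
    have h4 := Real.sq_sqrt hy.le
    nlinarith [sq_nonneg (√y - 1)]
  have h5 : y * √y ≤ Real.exp y := by
    calc y * √y ≤ Real.exp (y / 2) * Real.exp (y / 2) := by gcongr
      _ = Real.exp y := by rw [← Real.exp_add]; ring_nf
  rw [Real.exp_neg, ← one_div]
  have := Real.sqrt_pos.2 hy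
  exact one_div_le_one_div_of_le (by positivity) h5

/-- Linear growth of the gap ν - 1 over the regular modes. The slope α is forced by m = 1 and the
slope (1 - α)/2 by m = -2, where equality holds in the respective bounds. -/
theorem le_abs_add_sub_one (hα0 : 0 < α) (hα1 : α < 1) {m : ℤ} (h0 : m ≠ 0) (h1 : m ≠ -1) :
    min α ((1 - α) / 2) * |(m : ℝ)| ≤ |m + α| - 1 := by
  rcases lt_or_gt_of_ne h0 with h | h
  · have h2 : (m : ℝ) ≤ -2 := by
      have : m ≤ -2 := by omega
      exact_mod_cast this
    rw [abs_of_neg (by linarith), abs_of_neg (by linarith)]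
    have := min_le_right α ((1 - α) / 2)
    nlinarith
  · have h2 : (1 : ℝ) ≤ m := by exact_mod_cast h
    rw [abs_of_pos (by linarith), abs_of_pos (by linarith)]
    have := min_le_left α ((1 - α) / 2)
    nlinarith

/-- With δ the slope of the preceding lemma, both terms of the mode bound are controlled by
(δ|m|)^{-3/2}. The exponent is below -1, so the majorant is summable over m. -/
theorem IsModeSolution.exists_norm_le {z : ℂ} {T Q : ℝ} {F : ℤ → ℝ → ℂ} (hα0 : 0 < α)
    (hα1 : α < 1) (hF : ∀ m : ℤ, IsModeSolution z T |m + α| Q (F m)) :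
    ∃ K ≥ 0, ∀ m : ℤ, m ≠ 0 → m ≠ -1 → ∀ᵐ t : ℝ, t < T - 2 →
      ‖F m t‖ ≤ K * |(m : ℝ)| ^ (-(3 / 2) : ℝ) * Real.exp t := by
  have hQ := (hF 0).nonneg
  set δ := min α ((1 - α) / 2) with hδ
  have hδ0 : 0 < δ := lt_min hα0 (by linarith)
  set K := ‖z‖ * (1 + Q) / 2 + Real.exp (2 - 2 * T) * (1 + Q) with hK
  have hK0 : 0 ≤ K := by positivity
  refine ⟨K * δ ^ (-(3 / 2) : ℝ), by positivity, fun m h0 h1 => ?_⟩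
  have hm : 0 < |(m : ℝ)| := abs_pos.2 (by exact_mod_cast h0)
  have hle := le_abs_add_sub_one hα0 hα1 h0 h1
  rw [← hδ] at hle
  have hx : 0 < δ * |(m : ℝ)| := by positivity
  have hν : 1 < |m + α| := by linarith
  filter_upwards [(hF m).norm_le hν] with t ht hT
  refine (ht hT).trans ?_
  refine mul_le_mul_of_nonneg_right ?_ (Real.exp_pos t).le
  have hxs : 1 / (δ * |(m : ℝ)| * √(δ * |(m : ℝ)|)) =
      δ ^ (-(3 / 2) : ℝ) * |(m : ℝ)| ^ (-(3 / 2) : ℝ) := by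
    rw [← Real.mul_rpow hδ0.le hm.le, Real.rpow_neg hx.le, ← one_div,
      show (3 / 2 : ℝ) = 1 + 1 / 2 by norm_num, Real.rpow_add hx, Real.rpow_one,
      Real.sqrt_eq_rpow]
  have hsx := Real.sqrt_pos.2 hx
  have b1 : 1 / (|m + α| * √(|m + α| - 1)) ≤ 1 / (δ * |(m : ℝ)| * √(δ * |(m : ℝ)|)) := by
    refine one_div_le_one_div_of_le (by positivity) ?_
    have : δ * |(m : ℝ)| ≤ |m + α| := by linarith
    gcongr
  have b2 : Real.exp (-(|m + α| - 1)) ≤ 1 / (δ * |(m : ℝ)| * √(δ * |(m : ℝ)|)) :=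
    (Real.exp_le_exp.2 (neg_le_neg hle)).trans (exp_neg_le_inv_mul_sqrt hx)
  rw [mul_assoc K, ← hxs, hK, add_mul]
  gcongr

/-- Near the vortex, a square integrable weak solution is the sum of two singular terms and a
remainder that tends to zero. -/
theorem exists_singular_expansion {z : ℂ} {T : ℝ} (hα0 : 0 < α) (hα1 : α < 1)
    (hψ : StronglyMeasurable ψ) (h2 : MemLp ψ 2 volume) (hw : IsRadialWeakSolution z T α ψ) :
    ∃ (c₀ c₁ : ℂ) (C₀ C₁ S : ℝ), ∀ᵐ x : ℂ, Real.log ‖x‖ < T - 2 →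
      ‖ψ x - (c₀ * ((‖x‖ ^ (-α) : ℝ) : ℂ) * Complex.exp (Complex.I * α * Complex.arg x) +
        c₁ * ((‖x‖ ^ (-1 + α) : ℝ) : ℂ) * Complex.exp (Complex.I * (α - 1) * Complex.arg x))‖ ≤
        C₀ * ‖x‖ ^ α + C₁ * ‖x‖ ^ (1 - α) + S * ‖x‖ := by
  have hF := isModeSolution_angularMode hψ h2 hw
  obtain ⟨K, hK0, hK⟩ := IsModeSolution.exists_norm_le hα0 hα1 hF
  have hF0 := hF 0
  have hF1 := hF (-1)
  -- The modes 0 and -1 are exactly those with |m + α| < 1.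
  have a0 : |((0 : ℤ) : ℝ) + α| = α := by simp [abs_of_pos hα0]
  have a1 : |((-1 : ℤ) : ℝ) + α| = 1 - α := by
    push_cast
    rw [abs_of_neg (by linarith)]
    ring
  rw [a0] at hF0
  rw [a1] at hF1
  obtain ⟨c₀, C₀, h0⟩ := hF0.exists_norm_sub_le hα0 hα1
  obtain ⟨c₁, C₁, h1⟩ := hF1.exists_norm_sub_le (by linarith) (by linarith)
  have hsum : Summable fun m : ℤ => |(m : ℝ)| ^ (-(3 / 2) : ℝ) :=
    Real.summable_abs_int_rpow (by norm_num)
  refine ⟨c₀, c₁, C₀, C₁, K * ∑' m : ℤ, |(m : ℝ)| ^ (-(3 / 2) : ℝ), ?_⟩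
  have hmeas : MeasurableSet {x : ℂ | Real.log ‖x‖ < T - 2 →
      ‖ψ x - (c₀ * ((‖x‖ ^ (-α) : ℝ) : ℂ) * Complex.exp (Complex.I * α * Complex.arg x) +
        c₁ * ((‖x‖ ^ (-1 + α) : ℝ) : ℂ) * Complex.exp (Complex.I * (α - 1) * Complex.arg x))‖ ≤
        C₀ * ‖x‖ ^ α + C₁ * ‖x‖ ^ (1 - α) +
          (K * ∑' m : ℤ, |(m : ℝ)| ^ (-(3 / 2) : ℝ)) * ‖x‖} := by
    have := hψ.measurable
    have := Complex.measurable_arg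
    refine measurableSet_setOfPred.2 (Measurable.imp (measurableSet_setOfPred.1 ?_)
      (measurableSet_setOfPred.1 ?_))
    · exact measurableSet_lt (by fun_prop) (by fun_prop)
    · exact measurableSet_le (by fun_prop) (by fun_prop)
  refine ae_of_ae_ae_expMap hmeas ?_
  -- The modes are countably many, so their exceptional null sets can be merged into one.
  have hK' : ∀ᵐ t : ℝ, ∀ m : ℤ, m ≠ 0 → m ≠ -1 → t < T - 2 →
      ‖angularMode α ψ m t‖ ≤ K * |(m : ℝ)| ^ (-(3 / 2) : ℝ) * Real.exp t := by
    rw [ae_all_iff]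
    intro m
    by_cases e0 : m = 0
    · exact Eventually.of_forall fun t h => absurd e0 h
    by_cases e1 : m = -1
    · exact Eventually.of_forall fun t _ h => absurd e1 h
    filter_upwards [hK m e0 e1] with t ht _ _ using ht
  filter_upwards [h0, h1, hK', ae_memLp_polarFun α hψ h2] with t t0 t1 tK tL
  by_cases hT : t < T - 2
  swap
  · refine Eventually.of_forall fun θ h => absurd ?_ hT
    rwa [norm_expMap, Real.log_exp] at h
  have s0 := t0 (by linarith)
  have s1 := t1 (by linarith)
  have hfL : IntegrableOn (polarFun α ψ t) (Set.Ioc (-Real.pi) Real.pi) :=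
    tL.integrable (by norm_num)
  set b₀ : ℂ := c₀ * Complex.exp (-α * t) with hb₀
  set b₁ : ℂ := c₁ * Complex.exp (-(1 - α : ℝ) * t) with hb₁
  have hcf : ∀ k : ℤ, Continuous fun θ : ℝ =>
      (fourier k (θ : AddCircle (Real.pi - -Real.pi)) : ℂ) := fun k =>
    (fourier k : C(AddCircle (Real.pi - -Real.pi), ℂ)).continuous.comp (AddCircle.continuous_mk' _)
  have hcL : ∀ (c : ℂ) (k : ℤ), MemLp (fun θ : ℝ => c *
      (fourier k (θ : AddCircle (Real.pi - -Real.pi)) : ℂ)) 2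
        (volume.restrict (Set.Ioc (-Real.pi) Real.pi)) := by
    intro c k
    refine MemLp.of_bound (continuous_const.mul (hcf k)).aestronglyMeasurable ‖c‖
      (Eventually.of_forall fun θ => ?_)
    have := Fact.mk (by linarith [Real.pi_pos] : 0 < Real.pi - -Real.pi)
    rw [norm_mul]
    exact mul_le_of_le_one_right (norm_nonneg _)
      (((fourier k : C(AddCircle (Real.pi - -Real.pi), ℂ)).norm_coe_le_norm _).trans_eq
        (fourier_norm _))
  have hd0 : Summable fun m : ℤ => if m = 0 then C₀ * Real.exp (α * t) else 0 :=
    (hasSum_ite_eq 0 _).summable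
  have hd1 : Summable fun m : ℤ => if m = -1 then C₁ * Real.exp ((1 - α) * t) else 0 :=
    (hasSum_ite_eq (-1) _).summable
  have hd2 : Summable fun m : ℤ => K * |(m : ℝ)| ^ (-(3 / 2) : ℝ) * Real.exp t :=
    (hsum.mul_left K).mul_right _
  -- At fixed r, subtracting the two singular terms changes only the Fourier coefficients 0 and -1,
  -- so the remainder is bounded by the sum of the mode bounds.
  have key := ae_norm_le_tsum_of_fourierCoeffOn (neg_lt_self Real.pi_pos)
    ((tL.sub (hcL b₀ 0)).sub (hcL b₁ (-1))) ((hd0.add hd1).add hd2) ?_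
  · rw [(hd0.add hd1).tsum_add hd2, hd0.tsum_add hd1, tsum_ite_eq, tsum_ite_eq, tsum_mul_right,
      tsum_mul_left] at key
    filter_upwards [key, ae_restrict_mem measurableSet_Ioc] with θ hθ hm _
    have hf1 : (fourier (-1) (θ : AddCircle (Real.pi - -Real.pi)) : ℂ) =
        Complex.exp (-Complex.I * θ) := by
      have := fourier_neg_coe 1 θ
      simpa using this
    rw [arg_expMap (p := (t, θ)) hm, norm_expMap, ← Real.exp_mul, ← Real.exp_mul, ← Real.exp_mul,
      ← Real.exp_mul]
    simp only [Pi.sub_apply, fourier_zero, hf1, mul_one] at hθ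
    have e : ψ (expMap (t, θ)) - (c₀ * ((Real.exp (t * -α) : ℝ) : ℂ) *
        Complex.exp (Complex.I * α * θ) + c₁ * ((Real.exp (t * (-1 + α)) : ℝ) : ℂ) *
          Complex.exp (Complex.I * (α - 1) * θ)) =
        Complex.exp (Complex.I * (α * θ)) *
          (polarFun α ψ t θ - b₀ - b₁ * Complex.exp (-Complex.I * θ)) := by
      rw [polarFun, hb₀, hb₁]
      have e1 : Complex.exp (Complex.I * (α * θ)) * Complex.exp (-Complex.I * (α * θ)) = 1 := by
        rw [← Complex.exp_add]; simp
      have e2 : Complex.exp (Complex.I * (α - 1) * θ) =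
          Complex.exp (Complex.I * (α * θ)) * Complex.exp (-Complex.I * θ) := by
        rw [← Complex.exp_add]; ring_nf
      rw [e2]
      push_cast
      rw [show (t : ℂ) * -α = -α * t by ring, show (t : ℂ) * (-1 + α) = -(1 - α) * t by ring,
        show Complex.I * α * θ = Complex.I * (α * θ) by ring]
      linear_combination (-ψ (expMap (t, θ))) * e1
    have e3 : ‖Complex.exp (Complex.I * (α * θ))‖ = 1 := by
      have := norm_cexp_neg_I_mul (-(α * θ))
      push_cast at this
      rwa [neg_mul_neg] at this
    rw [e, norm_mul, e3, one_mul]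
    refine hθ.trans_eq ?_
    simp only [mul_comm t]
  · intro m
    have i1 := (tL.sub (hcL b₀ 0)).integrable (μ := volume.restrict (Set.Ioc (-Real.pi) Real.pi))
      (by norm_num)
    have r1 := fourierCoeffOn_sub_const_mul_fourier (neg_lt_self Real.pi_pos) hfL b₀ 0 m
    have r2 := fourierCoeffOn_sub_const_mul_fourier (neg_lt_self Real.pi_pos) i1 b₁ (-1) m
    have r3 : fourierCoeffOn (neg_lt_self Real.pi_pos) ((polarFun α ψ t - fun θ : ℝ => b₀ *
        (fourier 0 (θ : AddCircle (Real.pi - -Real.pi)) : ℂ)) - fun θ : ℝ => b₁ *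
          (fourier (-1) (θ : AddCircle (Real.pi - -Real.pi)) : ℂ)) m =
        angularMode α ψ m t - (if m = 0 then b₀ else 0) - if m = -1 then b₁ else 0 :=
      r2.trans (congrArg (· - _) r1)
    rw [r3]
    -- The third majorant also has terms at m = 0 and m = -1, where it is superfluous; only its sign
    -- is used there.
    have hnn : 0 ≤ K * |(m : ℝ)| ^ (-(3 / 2) : ℝ) * Real.exp t := by positivity
    by_cases e0 : m = 0
    · subst e0
      simp only [if_true, show (0 : ℤ) ≠ -1 by decide, if_false, sub_zero, add_zero]
      linarith
    by_cases e1 : m = -1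
    · subst e1
      simp only [if_true, show (-1 : ℤ) ≠ 0 by decide, if_false, sub_zero, zero_add]
      linarith
    simp only [e0, e1, if_false, sub_zero, zero_add]
    exact tK m e0 e1 hT

end AharonovBohm

/-! ### Test functions, the Hamiltonian and the weak equation -/

namespace AharonovBohm

open scoped ComplexConjugate

variable {α β ρ : ℝ}

theorem contDiffAt_vecPot1 {x : ℂ} (h0 : x ≠ 0) (h1 : x ≠ ρ) :
    ContDiffAt ℝ ∞ (vecPot1 α β ρ) x := by
  have e0 : ‖x‖ ^ 2 ≠ 0 := by simpa using h0
  have e1 : ‖x - ρ‖ ^ 2 ≠ 0 := by simpa [sub_eq_zero] using h1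
  have him : ContDiffAt ℝ ∞ Complex.im x := Complex.imCLM.contDiff.contDiffAt
  have hn0 : ContDiffAt ℝ ∞ (fun x : ℂ => ‖x‖ ^ 2) x := (contDiff_norm_sq ℝ).contDiffAt
  have hn1 : ContDiffAt ℝ ∞ (fun x : ℂ => ‖x - ρ‖ ^ 2) x :=
    ((contDiff_norm_sq ℝ).comp (contDiff_id.sub contDiff_const)).contDiffAt
  exact ((contDiffAt_const.mul him).div hn0 e0).add ((contDiffAt_const.mul him).div hn1 e1)

theorem contDiffAt_vecPot2 {x : ℂ} (h0 : x ≠ 0) (h1 : x ≠ ρ) :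
    ContDiffAt ℝ ∞ (vecPot2 α β ρ) x := by
  have e0 : ‖x‖ ^ 2 ≠ 0 := by simpa using h0
  have e1 : ‖x - ρ‖ ^ 2 ≠ 0 := by simpa [sub_eq_zero] using h1
  have hre : ContDiffAt ℝ ∞ Complex.re x := Complex.reCLM.contDiff.contDiffAt
  have hn0 : ContDiffAt ℝ ∞ (fun x : ℂ => ‖x‖ ^ 2) x := (contDiff_norm_sq ℝ).contDiffAt
  have hn1 : ContDiffAt ℝ ∞ (fun x : ℂ => ‖x - ρ‖ ^ 2) x :=
    ((contDiff_norm_sq ℝ).comp (contDiff_id.sub contDiff_const)).contDiffAt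
  exact ((contDiffAt_const.mul hre).div hn0 e0).neg.sub
    ((contDiffAt_const.mul (hre.sub contDiffAt_const)).div hn1 e1)

/-- The potential is singular at the vortices, but φ vanishes near them, so the class of test
functions is stable and the operator can be iterated. -/
theorem IsTest.combination {φ : ℂ → ℂ} (h : IsTest ρ φ) (v : ℂ) {A : ℂ → ℝ}
    (hA : ∀ x : ℂ, x ≠ 0 → x ≠ ρ → ContDiffAt ℝ ∞ A x) :
    IsTest ρ fun x => -Complex.I * fderiv ℝ φ x v - A x * φ x := by
  have hz : ∀ p : ℂ, φ =ᶠ[𝓝 p] 0 →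
      (fun x => -Complex.I * fderiv ℝ φ x v - A x * φ x) =ᶠ[𝓝 p] 0 := by
    intro p hp
    filter_upwards [IsTest.fderiv_eventually hp v] with x hx
    simp [hx.1, hx.2]
  refine ⟨?_, h.hasCompactSupport_combination v A, hz _ h.2.2.1, hz _ h.2.2.2⟩
  rw [contDiff_iff_contDiffAt]
  intro x
  have hzx : φ =ᶠ[𝓝 x] 0 →
      ContDiffAt ℝ ∞ (fun x => -Complex.I * fderiv ℝ φ x v - A x * φ x) x := fun hx =>
    (contDiffAt_const (c := (0 : ℂ))).congr_of_eventuallyEq (hz x hx)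
  by_cases h0 : x = 0
  · subst h0; exact hzx h.2.2.1
  by_cases h1 : x = ρ
  · subst h1; exact hzx h.2.2.2
  have hd : ContDiff ℝ ∞ fun x => fderiv ℝ φ x v :=
    (h.1.fderiv_right (by simp)).clm_apply contDiff_const
  exact (contDiffAt_const.mul hd.contDiffAt).sub
    ((Complex.ofRealCLM.contDiff.contDiffAt.comp x (hA x h0 h1)).mul h.1.contDiffAt)

theorem IsTest.kin1 {φ : ℂ → ℂ} (h : IsTest ρ φ) : IsTest ρ (kin1 α β ρ φ) :=
  h.combination 1 fun _ h0 h1 => contDiffAt_vecPot1 h0 h1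

theorem IsTest.kin2 {φ : ℂ → ℂ} (h : IsTest ρ φ) : IsTest ρ (kin2 α β ρ φ) :=
  h.combination Complex.I fun _ h0 h1 => contDiffAt_vecPot2 h0 h1

theorem IsTest.add {φ χ : ℂ → ℂ} (hφ : IsTest ρ φ) (hχ : IsTest ρ χ) : IsTest ρ (φ + χ) :=
  ⟨hφ.1.add hχ.1, hφ.2.1.add hχ.2.1, by simpa using hφ.2.2.1.add hχ.2.2.1,
    by simpa using hφ.2.2.2.add hχ.2.2.2⟩

/-- The differential operator `(-i∇ - A)²`. -/
noncomputable def energyOp (α β ρ : ℝ) (φ : ℂ → ℂ) : ℂ → ℂ :=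
  kin1 α β ρ (kin1 α β ρ φ) + kin2 α β ρ (kin2 α β ρ φ)

theorem IsTest.energyOp {φ : ℂ → ℂ} (h : IsTest ρ φ) : IsTest ρ (energyOp α β ρ φ) :=
  h.kin1.kin1.add h.kin2.kin2

/-- Formal self-adjointness of the components of `-i∇ - A` on test functions. -/
theorem IsTest.integral_conj_combination_mul {φ χ : ℂ → ℂ} (hφ : IsTest ρ φ) (hχ : IsTest ρ χ)
    (v : ℂ) {A : ℂ → ℝ} (hA : ∀ x : ℂ, x ≠ 0 → x ≠ ρ → ContDiffAt ℝ ∞ A x) :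
    ∫ x, conj (-Complex.I * fderiv ℝ φ x v - A x * φ x) * χ x =
      ∫ x, conj (φ x) * (-Complex.I * fderiv ℝ χ x v - A x * χ x) := by
  have hKφ := hφ.combination v hA
  have hKχ := hχ.combination v hA
  have hconj : ContDiff ℝ ∞ fun x => conj (φ x) := Complex.conjCLE.contDiff.comp hφ.1
  have i1 : Integrable fun x => conj (-Complex.I * fderiv ℝ φ x v - A x * φ x) * χ x :=
    Continuous.integrable_of_hasCompactSupport
      ((Complex.continuous_conj.comp hKφ.1.continuous).mul hχ.1.continuous) hχ.2.1.mul_left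
  have i2 : Integrable fun x => conj (φ x) * (-Complex.I * fderiv ℝ χ x v - A x * χ x) :=
    Continuous.integrable_of_hasCompactSupport
      (hconj.continuous.mul hKχ.1.continuous) hKχ.2.1.mul_left
  have hf : ∀ x, fderiv ℝ (fun x => conj (φ x)) x v = conj (fderiv ℝ φ x v) := by
    intro x
    have h1 := (Complex.conjCLE.hasFDerivAt (x := φ x)).comp x
      ((hφ.1.differentiable (by simp)) x).hasFDerivAt
    have h2 : fderiv ℝ (fun x => conj (φ x)) x = _ := h1.fderiv
    rw [h2]
    simp
  have hcχ : Continuous fun x => fderiv ℝ χ x v :=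
    (hχ.1.continuous_fderiv (by simp)).clm_apply continuous_const
  have hcφ : Continuous fun x => fderiv ℝ (fun x => conj (φ x)) x v :=
    (hconj.continuous_fderiv (by simp)).clm_apply continuous_const
  have hcs : HasCompactSupport fun x => conj (φ x) :=
    hφ.2.1.comp_left (g := fun w : ℂ => conj w) (by simp)
  have j1 : Integrable fun x => fderiv ℝ (fun x => conj (φ x)) x v * χ x :=
    (hcφ.mul hχ.1.continuous).integrable_of_hasCompactSupport hχ.2.1.mul_left
  have j2 : Integrable fun x => conj (φ x) * fderiv ℝ χ x v :=
    (hconj.continuous.mul hcχ).integrable_of_hasCompactSupport hcs.mul_right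
  have j3 : Integrable fun x => conj (φ x) * χ x :=
    (hconj.continuous.mul hχ.1.continuous).integrable_of_hasCompactSupport hχ.2.1.mul_left
  have hparts := integral_mul_fderiv_eq_neg_fderiv_mul_of_integrable j1 j2 j3
    (fun x _ => hconj.differentiable (by simp) x) (fun x _ => hχ.1.differentiable (by simp) x)
  rw [← sub_eq_zero, ← integral_sub i1 i2]
  have e : ∀ x, conj (-Complex.I * fderiv ℝ φ x v - A x * φ x) * χ x -
      conj (φ x) * (-Complex.I * fderiv ℝ χ x v - A x * χ x) =
      Complex.I * (fderiv ℝ (fun x => conj (φ x)) x v * χ x + conj (φ x) * fderiv ℝ χ x v) := by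
    intro x
    rw [hf]
    simp only [map_sub, map_mul, map_neg, Complex.conj_I, Complex.conj_ofReal]
    ring
  simp only [e]
  rw [integral_const_mul, integral_add j1 j2, hparts]
  simp

theorem inner_toLp_eq {f g : ℂ → ℂ} (hf : MemLp f 2 volume) (hg : MemLp g 2 volume) :
    inner ℂ (hf.toLp f) (hg.toLp g) = ∫ x, conj (f x) * g x := by
  rw [L2.inner_def]
  refine integral_congr_ae ?_
  filter_upwards [hf.coeFn_toLp, hg.coeFn_toLp] with x h1 h2
  rw [h1, h2]
  simp [mul_comm]

/-- The form identity holds against test functions by integration by parts. Both sides are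
continuous in (f, v₁, v₂), so it persists on the closure, which is the form domain. -/
theorem IsTest.mem_hamiltonian0Graph {φ : ℂ → ℂ} (h : IsTest ρ φ) :
    (h.memLp.toLp φ, (h.energyOp (α := α) (β := β)).memLp.toLp _) ∈ hamiltonian0Graph α β ρ := by
  have h1 := h.kin1 (α := α) (β := β)
  have h2 := h.kin2 (α := α) (β := β)
  have hE := h.energyOp (α := α) (β := β)
  refine ⟨h1.memLp.toLp _, h2.memLp.toLp _, h.mem_formGraph, ?_⟩
  have hcl : IsClosed {p : L2 × L2 × L2 | inner ℂ p.2.1 (h1.memLp.toLp _) +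
      inner ℂ p.2.2 (h2.memLp.toLp _) = inner ℂ p.1 (hE.memLp.toLp _)} :=
    isClosed_eq (by fun_prop) (by fun_prop)
  have hsub : ((gradGraph α β ρ : Submodule ℂ (L2 × L2 × L2)) : Set (L2 × L2 × L2)) ⊆
      {p : L2 × L2 × L2 | inner ℂ p.2.1 (h1.memLp.toLp _) +
        inner ℂ p.2.2 (h2.memLp.toLp _) = inner ℂ p.1 (hE.memLp.toLp _)} := by
    rintro ⟨f, v₁, v₂⟩ ⟨χ, hχ, e0, e1, e2⟩
    have k1 := hχ.kin1 (α := α) (β := β)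
    have k2 := hχ.kin2 (α := α) (β := β)
    have r0 : f = hχ.memLp.toLp χ := Lp.ext (e0.trans hχ.memLp.coeFn_toLp.symm)
    have r1 : v₁ = k1.memLp.toLp _ := Lp.ext (e1.trans k1.memLp.coeFn_toLp.symm)
    have r2 : v₂ = k2.memLp.toLp _ := Lp.ext (e2.trans k2.memLp.coeFn_toLp.symm)
    change inner ℂ v₁ _ + inner ℂ v₂ _ = inner ℂ f _
    rw [r0, r1, r2, inner_toLp_eq, inner_toLp_eq, inner_toLp_eq]
    have s1 := hχ.integral_conj_combination_mul h1 1
      fun _ h0 h1 => contDiffAt_vecPot1 (α := α) (β := β) h0 h1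
    have s2 := hχ.integral_conj_combination_mul h2 Complex.I
      fun _ h0 h1 => contDiffAt_vecPot2 (α := α) (β := β) h0 h1
    have hi : ∀ {k : ℂ → ℂ}, IsTest ρ k → Integrable fun x => conj (χ x) * k x := fun hk =>
      ((Complex.continuous_conj.comp hχ.1.continuous).mul
        hk.1.continuous).integrable_of_hasCompactSupport hk.2.1.mul_left
    refine (congrArg₂ (· + ·) s1 s2).trans ?_
    refine (integral_add (hi h1.kin1) (hi h2.kin2)).symm.trans ?_
    congr 1
    funext x
    rw [← mul_add]
    rfl
  intro f v₁ v₂ hf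
  exact closure_minimal hsub hcl hf

/-! ### The gauge factor and the domain of the symmetric operator -/

theorem norm_phase (α β ρ : ℝ) (x : ℂ) : ‖phase α β ρ x‖ = 1 := by
  rw [phase, Complex.norm_exp]
  simp

theorem conj_phase_mul_phase (α β ρ : ℝ) (x : ℂ) : conj (phase α β ρ x) * phase α β ρ x = 1 := by
  rw [← Complex.normSq_eq_conj_mul_self, Complex.normSq_eq_norm_sq, norm_phase]
  simp

theorem measurable_phase (α β ρ : ℝ) : Measurable (phase α β ρ) := by
  have := Complex.measurable_arg
  unfold phase thetaA thetaB
  fun_prop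

theorem memLp_phase_mul {f : ℂ → ℂ} (hf : MemLp f 2 volume) :
    MemLp (fun x => phase α β ρ x * f x) 2 volume := by
  refine hf.of_le ((measurable_phase α β ρ).aestronglyMeasurable.mul hf.1)
    (Eventually.of_forall fun x => ?_)
  rw [norm_mul, norm_phase, one_mul]

theorem memLp_conj_phase_mul {f : ℂ → ℂ} (hf : MemLp f 2 volume) :
    MemLp (fun x => conj (phase α β ρ x) * f x) 2 volume := by
  refine hf.of_le ((Complex.continuous_conj.measurable.comp
    (measurable_phase α β ρ)).aestronglyMeasurable.mul hf.1) (Eventually.of_forall fun x => ?_)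
  rw [norm_mul, RCLike.norm_conj, norm_phase, one_mul]

theorem exists_ball_of_eventually_zero {φ : ℂ → ℂ} {p : ℂ} (h : φ =ᶠ[𝓝 p] 0) :
    ∃ ε > 0, ∀ x, ‖x - p‖ < ε → φ x = 0 := by
  obtain ⟨ε, hε, hb⟩ := Metric.eventually_nhds_iff.1 h
  exact ⟨ε, hε, fun x hx => hb (by rwa [dist_eq_norm])⟩

theorem IsTest.mem_vanishNearVortices {φ : ℂ → ℂ} (h : IsTest ρ φ) :
    (memLp_phase_mul (α := α) (β := β) (ρ := ρ) h.memLp).toLp _ ∈ vanishNearVortices ρ := by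
  obtain ⟨ε, hε, h1⟩ := exists_ball_of_eventually_zero h.2.2.1
  obtain ⟨δ, hδ, h2⟩ := exists_ball_of_eventually_zero h.2.2.2
  refine ⟨min ε δ, lt_min hε hδ, ?_⟩
  filter_upwards [(memLp_phase_mul (α := α) (β := β) (ρ := ρ) h.memLp).coeFn_toLp] with x hx hor
  rw [hx]
  rcases hor with hl | hl
  · rw [h1 x (by rw [sub_zero]; exact lt_of_lt_of_le hl (min_le_left _ _)), mul_zero]
  · rw [h2 x (lt_of_lt_of_le hl (min_le_right _ _)), mul_zero]

/-- Test functions belong, after the gauge transformation, to the domain of the symmetric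
operator. -/
theorem IsTest.exists_mem_domain {φ : ℂ → ℂ} (h : IsTest ρ φ) :
    ∃ x : (symmOp α β ρ).domain,
      (x : L2) = (memLp_phase_mul (α := α) (β := β) (ρ := ρ) h.memLp).toLp _ ∧
      symmOp α β ρ x =
        (memLp_phase_mul (α := α) (β := β) (ρ := ρ)
          (h.energyOp (α := α) (β := β)).memLp).toLp _ := by
  have hg : ((memLp_phase_mul (α := α) (β := β) (ρ := ρ) h.memLp).toLp _,
      (memLp_phase_mul (α := α) (β := β) (ρ := ρ)
        (h.energyOp (α := α) (β := β)).memLp).toLp _) ∈ (hamiltonian α β ρ).graph := by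
    rw [hamiltonian_graph]
    refine ⟨_, h.mem_hamiltonian0Graph, ?_, ?_⟩
    · filter_upwards [(memLp_phase_mul (α := α) (β := β) (ρ := ρ) h.memLp).coeFn_toLp,
        h.memLp.coeFn_toLp] with x h1 h2
      rw [h1, h2]
    · filter_upwards [(memLp_phase_mul (α := α) (β := β) (ρ := ρ)
        (h.energyOp (α := α) (β := β)).memLp).coeFn_toLp,
        (h.energyOp (α := α) (β := β)).memLp.coeFn_toLp] with x h1 h2
      rw [h1, h2]
  obtain ⟨y, hy1, hy2⟩ := (LinearPMap.mem_graph_iff _).1 hg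
  refine ⟨⟨y, ⟨?_, y.2⟩⟩, hy1, ?_⟩
  · simp only at hy1
    rw [hy1]
    exact h.mem_vanishNearVortices
  · exact (LinearPMap.domRestrict_apply rfl).trans hy2

/-- The domain contains Uφ for all test functions φ, and only 0 is orthogonal to these. Density is
what gives access to the defining relation of the adjoint. -/
theorem dense_domain_symmOp (α β ρ : ℝ) : Dense ((symmOp α β ρ).domain : Set L2) := by
  rw [Submodule.dense_iff_topologicalClosure_eq_top, Submodule.topologicalClosure_eq_top_iff,
    Submodule.eq_bot_iff]
  intro g hg
  have hgL := memLp_conj_phase_mul (α := α) (β := β) (ρ := ρ) (Lp.memLp g)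
  have h0 : hgL.toLp _ = 0 := by
    refine eq_zero_of_inner_test (ρ := ρ) _ fun φ hφ => ?_
    obtain ⟨x, hx, -⟩ := hφ.exists_mem_domain (α := α) (β := β)
    have h1 := (Submodule.mem_orthogonal _ _).1 hg x x.2
    rw [hx, L2.inner_def] at h1
    rw [inner_toLp_eq, ← h1]
    refine integral_congr_ae ?_
    filter_upwards [(memLp_phase_mul (α := α) (β := β) (ρ := ρ) hφ.memLp).coeFn_toLp] with x hx
    rw [hx]
    simp [mul_comm]
    ring
  rw [Lp.eq_zero_iff_ae_eq_zero] at h0 ⊢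
  filter_upwards [h0, hgL.coeFn_toLp] with x h1 h2
  rw [h2] at h1
  have h3 := conj_phase_mul_phase α β ρ x
  have h4 : conj (phase α β ρ x) ≠ 0 := left_ne_zero_of_mul_eq_one h3
  simpa [h4] using h1

/-- The equation `-Δψ = zψ` with the Aharonov-Bohm boundary conditions, tested against the gauge
transformed test functions. -/
def IsWeakSolution (z : ℂ) (α β ρ : ℝ) (ψ : ℂ → ℂ) : Prop :=
  ∀ φ : ℂ → ℂ, IsTest ρ φ →
    ∫ x, ψ x * conj (phase α β ρ x * (energyOp α β ρ φ x - conj z * φ x)) = 0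

/-- The kernel of X* - z is orthogonal to the range of X - z̄; only the vectors Uφ of the domain are
tested. -/
theorem isWeakSolution_of_mem_deficiencySpace {z : ℂ} {ψ : L2}
    (hψ : ψ ∈ deficiencySpace α β ρ z) : IsWeakSolution z α β ρ ψ := by
  intro φ hφ
  obtain ⟨y, hy, rfl⟩ := hψ
  have hy0 : (symmOp α β ρ).adjoint y = z • (y : L2) := by
    have : (symmOp α β ρ).adjoint y - z • (y : L2) = 0 := hy
    exact sub_eq_zero.1 this
  obtain ⟨x, hx1, hx2⟩ := hφ.exists_mem_domain (α := α) (β := β)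
  have hadj := LinearPMap.adjoint_isFormalAdjoint (dense_domain_symmOp α β ρ) y x
  have hE := hφ.energyOp (α := α) (β := β)
  have i1 := (memLp_phase_mul (α := α) (β := β) (ρ := ρ) hE.memLp)
  have i2 := (memLp_phase_mul (α := α) (β := β) (ρ := ρ) hφ.memLp)
  rw [hx1, hx2, hy0] at hadj
  have h0 : inner ℂ (i1.toLp _ - conj z • i2.toLp _) (y : L2) = 0 := by
    rw [inner_sub_left, inner_smul_left, Complex.conj_conj, sub_eq_zero,
      ← inner_conj_symm, ← hadj, inner_conj_symm, inner_smul_right]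
  rw [L2.inner_def] at h0
  rw [← h0]
  refine integral_congr_ae ?_
  filter_upwards [Lp.coeFn_sub (i1.toLp _) (conj z • i2.toLp _), Lp.coeFn_smul (conj z) (i2.toLp _),
    i1.coeFn_toLp, i2.coeFn_toLp] with x h1 h2 h3 h4
  rw [h1, Pi.sub_apply, h2, Pi.smul_apply, h3, h4, RCLike.inner_apply]
  simp only [Submodule.coe_subtype, smul_eq_mul]
  congr 2
  ring

end AharonovBohm

/-! ### Symmetry and angular exponentials -/

namespace AharonovBohm

open scoped ComplexConjugate

variable {α β ρ : ℝ}

theorem fderiv_comp_const_sub_apply (φ : ℂ → ℂ) (a x v : ℂ) :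
    fderiv ℝ (fun y => φ (a - y)) x v = -fderiv ℝ φ (a - x) v := by
  have h := (ContinuousLinearEquiv.neg ℝ (M := ℂ)).comp_right_fderiv
    (f := fun y => φ (a + y)) (x := x)
  have e : (fun y => φ (a + y)) ∘ (ContinuousLinearEquiv.neg ℝ (M := ℂ)) = fun y => φ (a - y) := by
    funext y
    simp [sub_eq_add_neg]
  rw [e, fderiv_comp_add_left] at h
  rw [h]
  simp [sub_eq_add_neg]

/-- Under the half-turn both the derivative and the potential change sign, once the fluxes are
exchanged. The signs disappear in the second order operator. -/
theorem kin1_reflect (φ : ℂ → ℂ) (x : ℂ) :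
    kin1 α β ρ (fun y => φ (ρ - y)) x = -kin1 β α ρ φ (ρ - x) := by
  have h : vecPot1 α β ρ x = -vecPot1 β α ρ (ρ - x) := by
    simp only [vecPot1, Complex.sub_im, Complex.ofReal_im, sub_sub_cancel_left, norm_neg,
      norm_sub_rev (ρ : ℂ) x]
    ring
  simp only [kin1, h, fderiv_comp_const_sub_apply]
  push_cast
  ring

theorem kin2_reflect (φ : ℂ → ℂ) (x : ℂ) :
    kin2 α β ρ (fun y => φ (ρ - y)) x = -kin2 β α ρ φ (ρ - x) := by
  have h : vecPot2 α β ρ x = -vecPot2 β α ρ (ρ - x) := by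
    simp only [vecPot2, Complex.sub_re, Complex.ofReal_re, sub_sub_cancel_left, norm_neg,
      norm_sub_rev (ρ : ℂ) x]
    ring
  simp only [kin2, h, fderiv_comp_const_sub_apply]
  push_cast
  ring

theorem kin1_neg (φ : ℂ → ℂ) (x : ℂ) :
    kin1 α β ρ (fun y => -φ y) x = -kin1 α β ρ φ x := by
  simp only [kin1, fderiv_fun_neg, neg_apply]
  ring

theorem kin2_neg (φ : ℂ → ℂ) (x : ℂ) :
    kin2 α β ρ (fun y => -φ y) x = -kin2 α β ρ φ x := by
  simp only [kin2, fderiv_fun_neg, neg_apply]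
  ring

theorem energyOp_reflect (φ : ℂ → ℂ) (x : ℂ) :
    energyOp α β ρ (fun y => φ (ρ - y)) x = energyOp β α ρ φ (ρ - x) := by
  simp only [energyOp, Pi.add_apply]
  rw [funext (kin1_reflect φ), funext (kin2_reflect φ), kin1_neg, kin2_neg, kin1_reflect,
    kin2_reflect, neg_neg, neg_neg]

theorem IsTest.reflect {φ : ℂ → ℂ} (h : IsTest ρ φ) : IsTest ρ fun y => φ (ρ - y) := by
  have hc : Continuous fun y : ℂ => (ρ : ℂ) - y := by fun_prop
  refine ⟨h.1.comp (contDiff_const.sub contDiff_id), ?_, ?_, ?_⟩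
  · exact h.2.1.comp_homeomorph (Homeomorph.subLeft (ρ : ℂ))
  · have := hc.tendsto 0
    rw [sub_zero] at this
    exact this.eventually h.2.2.2
  · have := hc.tendsto ρ
    rw [sub_self] at this
    exact this.eventually h.2.2.1

/-- The angle at b is the argument of ρ - x, so the half-turn exchanges the two angles together with
their cuts, without any branch correction. -/
theorem phase_reflect (x : ℂ) : phase β α ρ (ρ - x) = phase α β ρ x := by
  simp only [phase, thetaA, thetaB, sub_sub_cancel]
  rw [add_comm]

/-- The half-turn about the midpoint of the vortices exchanges them. -/
theorem IsWeakSolution.reflect {z : ℂ} {ψ : ℂ → ℂ} (h : IsWeakSolution z α β ρ ψ) :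
    IsWeakSolution z β α ρ fun x => ψ (ρ - x) := by
  intro φ hφ
  rw [← h _ hφ.reflect, ← integral_sub_left_eq_self _ _ (ρ : ℂ)]
  congr 1
  funext x
  simp only [energyOp_reflect, phase_reflect, sub_sub_cancel]

/-- The angular exponential `e^{imθ_a}`, gauge transformed by the flux at the other vortex. -/
noncomputable def angularExp (m : ℤ) (β ρ : ℝ) (x : ℂ) : ℂ :=
  Complex.exp (Complex.I * (m * Complex.arg x - β * Complex.arg (ρ - x)))

/-! ### Smooth branches and derivatives of the angular exponentials -/

theorem exp_I_mul_arg (m : ℤ) {x : ℂ} (hx : x ≠ 0) :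
    Complex.exp (Complex.I * (m * Complex.arg x)) = (x / ‖x‖) ^ m := by
  have hn : (‖x‖ : ℂ) ≠ 0 := by simpa using hx
  rw [mul_left_comm, Complex.exp_int_mul]
  congr 1
  rw [eq_div_iff hn, mul_comm, mul_comm Complex.I]
  exact Complex.norm_mul_exp_arg_mul_I x

/-- As m is an integer, the exponential is a power of x/|x| and does not see the cut. Near any x ≠ 0
the argument may thus be replaced by the branch Im log(y/x), smooth at y = x even when x lies on the
cut. -/
theorem exp_I_mul_arg_eq (m : ℤ) {x y : ℂ} (hx : x ≠ 0) (hy : y ≠ 0) :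
    Complex.exp (Complex.I * (m * Complex.arg y)) =
      Complex.exp (Complex.I * (m * Complex.arg x)) *
        Complex.exp (Complex.I * (m * (Complex.log (y / x)).im)) := by
  rw [Complex.log_im, exp_I_mul_arg m hx, exp_I_mul_arg m hy, exp_I_mul_arg m (div_ne_zero hy hx),
    ← mul_zpow]
  congr 1
  have : (‖x‖ : ℂ) ≠ 0 := by simpa using hx
  have : (‖y‖ : ℂ) ≠ 0 := by simpa using hy
  rw [norm_div]
  push_cast
  field_simp

theorem hasFDerivAt_re {f : ℂ → ℂ} {f' x : ℂ} (h : HasDerivAt f f' x) :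
    HasFDerivAt (fun y => (f y).re)
      (Complex.reCLM.comp ((ContinuousLinearMap.toSpanSingleton ℂ f').restrictScalars ℝ)) x :=
  Complex.reCLM.hasFDerivAt.comp x (h.hasFDerivAt.restrictScalars ℝ)

theorem hasFDerivAt_im {f : ℂ → ℂ} {f' x : ℂ} (h : HasDerivAt f f' x) :
    HasFDerivAt (fun y => (f y).im)
      (Complex.imCLM.comp ((ContinuousLinearMap.toSpanSingleton ℂ f').restrictScalars ℝ)) x :=
  Complex.imCLM.hasFDerivAt.comp x (h.hasFDerivAt.restrictScalars ℝ)

theorem hasDerivAt_log_div {x : ℂ} (hx : x ≠ 0) :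
    HasDerivAt (fun y => Complex.log (y / x)) (1 / x) x := by
  have h := ((hasDerivAt_id x).div_const x).clog (by
    simp only [id]
    rw [div_self hx]
    exact Complex.one_mem_slitPlane)
  simpa [hx] using h

theorem contDiffAt_log_div {x : ℂ} (hx : x ≠ 0) :
    ContDiffAt ℝ ∞ (fun y => Complex.log (y / x)) x := by
  have h1 : x / x ∈ Complex.slitPlane := by
    rw [div_self hx]
    exact Complex.one_mem_slitPlane
  exact ContDiffAt.comp (f := fun y : ℂ => y / x) x
    ((Complex.contDiffAt_log h1).restrict_scalars ℝ) (contDiffAt_id.div_const x)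

/-- The flux β is not an integer, so the angle at b must be kept away from its cut; the half-plane
Re x < ρ does this. -/
theorem mem_slitPlane_sub {x : ℂ} (hx : x.re < ρ) : (ρ : ℂ) - x ∈ Complex.slitPlane := by
  left
  simpa using hx

theorem hasDerivAt_log_sub {x : ℂ} (hx : x.re < ρ) :
    HasDerivAt (fun y => Complex.log (ρ - y)) (1 / (x - ρ)) x := by
  have h := ((hasDerivAt_id x).const_sub (ρ : ℂ)).clog (mem_slitPlane_sub hx)
  refine h.congr_deriv ?_
  rw [id, ← neg_sub x (ρ : ℂ), neg_div_neg_eq]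

theorem contDiffAt_log_sub {x : ℂ} (hx : x.re < ρ) :
    ContDiffAt ℝ ∞ (fun y => Complex.log (ρ - y)) x :=
  ((Complex.contDiffAt_log (mem_slitPlane_sub hx)).restrict_scalars ℝ).comp x
    (contDiffAt_const.sub contDiffAt_id)

theorem eventually_angularExp_eq (m : ℤ) {x : ℂ} (hx : x ≠ 0) :
    angularExp m β ρ =ᶠ[𝓝 x] fun y => Complex.exp (Complex.I * (m * Complex.arg x)) *
      Complex.exp (Complex.I *
        ((m * (Complex.log (y / x)).im - β * (Complex.log (ρ - y)).im : ℝ) : ℂ)) := by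
  filter_upwards [isOpen_ne.mem_nhds hx] with y hy
  have := exp_I_mul_arg_eq m hx hy
  rw [angularExp, mul_sub, sub_eq_add_neg, Complex.exp_add, this, mul_assoc, ← Complex.exp_add]
  congr 2
  push_cast
  rw [Complex.log_im (ρ - y)]
  ring

theorem contDiffAt_angularExp (m : ℤ) {x : ℂ} (hx : x ≠ 0) (hxρ : x.re < ρ) :
    ContDiffAt ℝ ∞ (angularExp m β ρ) x := by
  refine ContDiffAt.congr_of_eventuallyEq ?_ (eventually_angularExp_eq m hx)
  have him : ∀ {f : ℂ → ℂ}, ContDiffAt ℝ ∞ f x → ContDiffAt ℝ ∞ (fun y => (f y).im) x :=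
    fun hf => Complex.imCLM.contDiff.contDiffAt.comp x hf
  have h1 : ContDiffAt ℝ ∞ (fun y : ℂ =>
      m * (Complex.log (y / x)).im - β * (Complex.log (ρ - y)).im) x :=
    (contDiffAt_const.mul (him (contDiffAt_log_div hx))).sub
      (contDiffAt_const.mul (him (contDiffAt_log_sub hxρ)))
  exact contDiffAt_const.mul
    ((contDiffAt_const.mul (Complex.ofRealCLM.contDiff.contDiffAt.comp x h1)).cexp)

/-- The differential of log x on v is v/x: its imaginary part is dθ(v), its real part d(log r)(v).
-/
theorem fderiv_angularExp (m : ℤ) {x : ℂ} (hx : x ≠ 0) (hxρ : x.re < ρ) (v : ℂ) :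
    fderiv ℝ (angularExp m β ρ) x v =
      Complex.I * (m * (v / x).im - β * (v / (x - ρ)).im) * angularExp m β ρ x := by
  have h1 := ((hasFDerivAt_im (hasDerivAt_log_div hx)).const_mul (m : ℝ)).sub
    ((hasFDerivAt_im (hasDerivAt_log_sub hxρ)).const_mul β)
  have h2 := (((Complex.ofRealCLM.hasFDerivAt.comp x h1).const_mul Complex.I).cexp).const_mul
    (Complex.exp (Complex.I * (m * Complex.arg x)))
  have h3 := h2.congr_of_eventuallyEq (eventually_angularExp_eq m hx)
  rw [h3.fderiv, (eventually_angularExp_eq m hx).eq_of_nhds]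
  simp [div_eq_mul_inv]
  ring

theorem eventually_log_norm_eq {x : ℂ} (hx : x ≠ 0) :
    (fun y : ℂ => Real.log ‖y‖) =ᶠ[𝓝 x] fun y => (Complex.log (y / x)).re + Real.log ‖x‖ := by
  filter_upwards [isOpen_ne.mem_nhds hx] with y hy
  rw [Complex.log_re, norm_div, Real.log_div (norm_ne_zero_iff.2 hy) (norm_ne_zero_iff.2 hx)]
  ring

theorem contDiffAt_log_norm {x : ℂ} (hx : x ≠ 0) :
    ContDiffAt ℝ ∞ (fun y : ℂ => Real.log ‖y‖) x :=
  (contDiffAt_norm ℝ hx).log (norm_ne_zero_iff.2 hx)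

theorem hasFDerivAt_log_norm {x : ℂ} (hx : x ≠ 0) :
    HasFDerivAt (fun y : ℂ => Real.log ‖y‖) (Complex.reCLM.comp
      ((ContinuousLinearMap.toSpanSingleton ℂ (1 / x)).restrictScalars ℝ)) x :=
  ((hasFDerivAt_re (hasDerivAt_log_div hx)).add_const _).congr_of_eventuallyEq
    (eventually_log_norm_eq hx)

/-- The components of `-i∇ - A` in the gauge in which the flux is carried by `angularExp`. -/
theorem combination_mul_angularExp (m : ℤ) {x : ℂ} (hx : x ≠ 0) (hxρ : x.re < ρ) (v : ℂ)
    {S : ℂ → ℂ} (hS : DifferentiableAt ℝ S x) {a : ℝ}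
    (ha : a = -(α * (v / x).im) - β * (v / (x - ρ)).im) :
    -Complex.I * fderiv ℝ (fun y => S y * angularExp m β ρ y) x v -
        a * (S x * angularExp m β ρ x) =
      (-Complex.I * fderiv ℝ S x v + (m + α) * (v / x).im * S x) * angularExp m β ρ x := by
  have hE := (contDiffAt_angularExp (β := β) m hx hxρ).differentiableAt (by simp)
  rw [fderiv_fun_mul hS hE]
  simp only [add_apply, smul_apply, fderiv_angularExp m hx hxρ, smul_eq_mul, ha]
  push_cast
  linear_combination (-(S x * (m * (v / x).im - β * (v / (x - ρ)).im) * angularExp m β ρ x)) *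
    Complex.I_mul_I

/-- Evaluation of -α dθ_a - β dθ_b on the vector 1, with dθ(v) = Im(v/x). -/
theorem vecPot1_eq (α β ρ : ℝ) (x : ℂ) :
    vecPot1 α β ρ x = -(α * (1 / x).im) - β * (1 / (x - ρ)).im := by
  simp only [vecPot1, one_div, Complex.inv_im, Complex.normSq_eq_norm_sq, Complex.sub_im,
    Complex.ofReal_im, sub_zero]
  ring

theorem vecPot2_eq (α β ρ : ℝ) (x : ℂ) :
    vecPot2 α β ρ x = -(α * (Complex.I / x).im) - β * (Complex.I / (x - ρ)).im := by
  simp only [vecPot2, div_eq_mul_inv, Complex.mul_im, Complex.I_re, Complex.I_im, Complex.inv_re,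
    Complex.inv_im, Complex.normSq_eq_norm_sq, Complex.sub_re, Complex.ofReal_re]
  ring

theorem fderiv_comp_log_norm {k : ℝ → ℂ} (hk : Differentiable ℝ k) {x : ℂ} (hx : x ≠ 0) :
    HasFDerivAt (fun y : ℂ => k (Real.log ‖y‖))
      ((ContinuousLinearMap.toSpanSingleton ℝ (deriv k (Real.log ‖x‖))).comp
        (Complex.reCLM.comp ((ContinuousLinearMap.toSpanSingleton ℂ (1 / x)).restrictScalars ℝ)))
      x :=
  (hk _).hasDerivAt.hasFDerivAt.comp x (hasFDerivAt_log_norm hx)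

/-- The radial profile of the components of `(-i∇ - A)(k(log r) e^{imθ})`. -/
noncomputable def kinProfile (ν : ℂ) (v : ℂ) (k : ℝ → ℂ) (x : ℂ) : ℂ :=
  -Complex.I * ((v / x).re * deriv k (Real.log ‖x‖)) + ν * (v / x).im * k (Real.log ‖x‖)

/-- The derivative of y ↦ v/y at x in the direction v is -(v/x)², so everything is expressed through
the real and imaginary parts of v/x. -/
theorem fderiv_kinProfile (ν v : ℂ) {k : ℝ → ℂ} (hk : ContDiff ℝ ∞ k) {x : ℂ} (hx : x ≠ 0) :
    DifferentiableAt ℝ (kinProfile ν v k) x ∧ fderiv ℝ (kinProfile ν v k) x v =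
      -Complex.I * ((v / x).re ^ 2 * deriv (deriv k) (Real.log ‖x‖) -
        ((v / x).re ^ 2 - (v / x).im ^ 2) * deriv k (Real.log ‖x‖)) +
      ν * ((v / x).re * (v / x).im * deriv k (Real.log ‖x‖) -
        2 * ((v / x).re * (v / x).im) * k (Real.log ‖x‖)) := by
  have hk' : ContDiff ℝ ∞ (deriv k) := (contDiff_infty_iff_deriv.1 hk).2
  have h1 := fderiv_comp_log_norm (hk.differentiable (by simp)) hx
  have h2 := fderiv_comp_log_norm (hk'.differentiable (by simp)) hx
  have hd : HasDerivAt (fun y : ℂ => v / y) (-(v / x ^ 2)) x := by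
    refine ((hasDerivAt_const x v).div (hasDerivAt_id x) hx).congr_deriv ?_
    simp
    ring
  have h3 := Complex.ofRealCLM.hasFDerivAt.comp x (hasFDerivAt_re hd)
  have h4 := Complex.ofRealCLM.hasFDerivAt.comp x (hasFDerivAt_im hd)
  have h5 := ((h3.mul h2).const_mul (-Complex.I)).add ((h4.const_mul ν).mul h1)
  have h6 : HasFDerivAt (kinProfile ν v k) _ x := h5
  refine ⟨h6.differentiableAt, ?_⟩
  rw [h6.fderiv]
  have e : v * -(v / x ^ 2) = -(v / x * (v / x)) := by field_simp
  have e1 : (v * -(v / x ^ 2)).re = -((v / x).re ^ 2 - (v / x).im ^ 2) := by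
    rw [e, Complex.neg_re, Complex.mul_re]; ring
  have e2 : (v * -(v / x ^ 2)).im = -(2 * ((v / x).re * (v / x).im)) := by
    rw [e, Complex.neg_im, Complex.mul_im]; ring
  simp only [add_apply, smul_apply, ContinuousLinearMap.comp_apply,
    ContinuousLinearMap.coe_restrictScalars', ContinuousLinearMap.toSpanSingleton_apply,
    Complex.reCLM_apply, Complex.imCLM_apply, Complex.ofRealCLM_apply, Function.comp_apply,
    smul_eq_mul, mul_one_div, Complex.real_smul]
  simp only [e1, e2]
  push_cast
  ring

end AharonovBohm

/-! ### Separation of variables and the main result -/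

namespace AharonovBohm

open scoped ComplexConjugate

variable {α β ρ : ℝ}

/-- Radial functions times angular exponentials, supported in an annulus around `0`. -/
noncomputable def radialTest (m : ℤ) (β ρ : ℝ) (k : ℝ → ℂ) (x : ℂ) : ℂ :=
  k (Real.log ‖x‖) * angularExp m β ρ x

theorem apply_eq_zero_of_mem_testOn {T : ℝ} {g : ℝ → ℂ} (hg : g ∈ testOn T) {t : ℝ} (ht : T ≤ t) :
    g t = 0 := by
  obtain ⟨-, a, b, hb, h⟩ := hg
  by_contra h0
  linarith [(h t h0).2]

theorem exists_annulus_of_mem_testOn {T : ℝ} (hT : T ≤ 0) (hTρ : T ≤ Real.log ρ) (hρ : 0 < ρ)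
    {k : ℝ → ℂ} (hk : k ∈ testOn T) : ∃ r R : ℝ, 0 < r ∧ R < ρ ∧
      ∀ x : ℂ, k (Real.log ‖x‖) ≠ 0 → r < ‖x‖ ∧ ‖x‖ < R := by
  obtain ⟨-, a, b, hb, h⟩ := hk
  refine ⟨Real.exp a, Real.exp b, Real.exp_pos _, ?_, fun x hx => ?_⟩
  · rw [← Real.lt_log_iff_exp_lt hρ]
    linarith
  · obtain ⟨h1, h2⟩ := h _ hx
    -- By convention log 0 = 0, so the origin sits at t = 0; the assumption T ≤ 0 keeps it outside
    -- the support of k.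
    have hx0 : 0 < ‖x‖ := by
      refine lt_of_le_of_ne (norm_nonneg x) fun h0 => ?_
      rw [← h0, Real.log_zero] at h2
      linarith
    exact ⟨(Real.lt_log_iff_exp_lt hx0).1 h1, (Real.log_lt_iff_lt_exp hx0).1 h2⟩

theorem radialTest_eventually_zero (m : ℤ) {T : ℝ} (hT : T ≤ 0) (hTρ : T ≤ Real.log ρ) (hρ : 0 < ρ)
    {k : ℝ → ℂ} (hk : k ∈ testOn T) {x : ℂ} (hx : x = 0 ∨ ρ ≤ ‖x‖) :
    radialTest m β ρ k =ᶠ[𝓝 x] 0 := by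
  obtain ⟨r, R, hr, hR, h⟩ := exists_annulus_of_mem_testOn hT hTρ hρ hk
  rcases hx with rfl | hx
  · have : ∀ᶠ y : ℂ in 𝓝 0, ‖y‖ < r :=
      continuous_norm.tendsto' (0 : ℂ) 0 norm_zero |>.eventually (eventually_lt_nhds hr)
    filter_upwards [this] with y hy
    by_contra h0
    exact absurd (h y (left_ne_zero_of_mul h0)).1 (not_lt.2 hy.le)
  · have : ∀ᶠ y : ℂ in 𝓝 x, R < ‖y‖ :=
      (continuous_norm.tendsto x).eventually (eventually_gt_nhds (hR.trans_le hx))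
    filter_upwards [this] with y hy
    by_contra h0
    exact absurd (h y (left_ne_zero_of_mul h0)).2 (not_lt.2 hy.le)

theorem re_lt_of_norm_lt {x : ℂ} (hx : ‖x‖ < ρ) : x.re < ρ :=
  (Complex.re_le_norm x).trans_lt hx

/-- The support lies in an annulus 0 < r < |x| < R < ρ, which avoids both vortices and the cut of
the angle at b. -/
theorem isTest_radialTest (m : ℤ) {T : ℝ} (hT : T ≤ 0) (hTρ : T ≤ Real.log ρ) (hρ : 0 < ρ)
    {k : ℝ → ℂ} (hk : k ∈ testOn T) : IsTest ρ (radialTest m β ρ k) := by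
  refine ⟨?_, ?_, radialTest_eventually_zero m hT hTρ hρ hk (Or.inl rfl),
    radialTest_eventually_zero m hT hTρ hρ hk (Or.inr ?_)⟩
  · rw [contDiff_iff_contDiffAt]
    intro x
    by_cases hx : x = 0 ∨ ρ ≤ ‖x‖
    · exact contDiffAt_const.congr_of_eventuallyEq
        (radialTest_eventually_zero m hT hTρ hρ hk hx)
    · rw [not_or, not_le] at hx
      exact (hk.1.contDiffAt.comp x (contDiffAt_log_norm hx.1)).mul
        (contDiffAt_angularExp m hx.1 (re_lt_of_norm_lt hx.2))
  · obtain ⟨r, R, hr, hR, h⟩ := exists_annulus_of_mem_testOn hT hTρ hρ hk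
    refine HasCompactSupport.of_support_subset_isCompact (isCompact_closedBall (0 : ℂ) R) ?_
    intro x hx
    rw [mem_closedBall_zero_iff]
    exact (h x (left_ne_zero_of_mul hx)).2.le
  · rw [Complex.norm_real, Real.norm_of_nonneg hρ.le]

theorem kin_congr {φ χ : ℂ → ℂ} {x : ℂ} (h : φ =ᶠ[𝓝 x] χ) :
    kin1 α β ρ φ x = kin1 α β ρ χ x ∧ kin2 α β ρ φ x = kin2 α β ρ χ x := by
  simp only [kin1, kin2, h.fderiv_eq, h.eq_of_nhds, and_self]

theorem energyOp_eq_zero {φ : ℂ → ℂ} {x : ℂ} (h : φ =ᶠ[𝓝 x] 0) : energyOp α β ρ φ x = 0 := by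
  have h1 : kin1 α β ρ φ =ᶠ[𝓝 x] 0 := by
    filter_upwards [h.eventually_nhds] with y hy
    rw [(kin_congr hy).1]
    simp [kin1]
  have h2 : kin2 α β ρ φ =ᶠ[𝓝 x] 0 := by
    filter_upwards [h.eventually_nhds] with y hy
    rw [(kin_congr hy).2]
    simp [kin2]
  rw [energyOp, Pi.add_apply, (kin_congr h1).1, (kin_congr h2).2]
  simp [kin1, kin2]

theorem combination_radialTest (m : ℤ) {k : ℝ → ℂ} (hk : ContDiff ℝ ∞ k) {x : ℂ} (hx : x ≠ 0)
    (hxρ : x.re < ρ) (v : ℂ) {a : ℝ} (ha : a = -(α * (v / x).im) - β * (v / (x - ρ)).im) :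
    -Complex.I * fderiv ℝ (radialTest m β ρ k) x v - a * radialTest m β ρ k x =
      kinProfile (m + α) v k x * angularExp m β ρ x := by
  have h1 := fderiv_comp_log_norm (hk.differentiable (by simp)) hx
  have h2 := combination_mul_angularExp m hx hxρ v h1.differentiableAt ha
  rw [h1.fderiv] at h2
  refine h2.trans ?_
  simp only [kinProfile, ContinuousLinearMap.comp_apply,
    ContinuousLinearMap.coe_restrictScalars', ContinuousLinearMap.toSpanSingleton_apply,
    Complex.reCLM_apply, smul_eq_mul, mul_one_div, Complex.real_smul]

/-- In polar coordinates `(-i∇ - A)²` acts on each mode as `-r⁻² (d²/dt² - (m + α)²)`. -/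
theorem energyOp_radialTest (m : ℤ) {k : ℝ → ℂ} (hk : ContDiff ℝ ∞ k) {x : ℂ} (hx : x ≠ 0)
    (hxρ : x.re < ρ) : energyOp α β ρ (radialTest m β ρ k) x =
      -((‖x‖ : ℂ) ^ 2)⁻¹ * (deriv (deriv k) (Real.log ‖x‖) -
        (m + α) ^ 2 * k (Real.log ‖x‖)) * angularExp m β ρ x := by
  have hU : ∀ᶠ y : ℂ in 𝓝 x, y ≠ 0 ∧ y.re < ρ :=
    (isOpen_ne.eventually_mem hx).and
      ((Complex.continuous_re.tendsto x).eventually (eventually_lt_nhds hxρ))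
  have e1 : kin1 α β ρ (radialTest m β ρ k) =ᶠ[𝓝 x]
      fun y => kinProfile (m + α) 1 k y * angularExp m β ρ y := by
    filter_upwards [hU] with y hy
    exact combination_radialTest m hk hy.1 hy.2 1 (vecPot1_eq α β ρ y)
  have e2 : kin2 α β ρ (radialTest m β ρ k) =ᶠ[𝓝 x]
      fun y => kinProfile (m + α) Complex.I k y * angularExp m β ρ y := by
    filter_upwards [hU] with y hy
    exact combination_radialTest m hk hy.1 hy.2 Complex.I (vecPot2_eq α β ρ y)
  obtain ⟨d1, f1⟩ := fderiv_kinProfile (m + α) 1 hk hx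
  obtain ⟨d2, f2⟩ := fderiv_kinProfile (m + α) Complex.I hk hx
  have s1 := combination_mul_angularExp m hx hxρ 1 d1 (vecPot1_eq α β ρ x)
  have s2 := combination_mul_angularExp m hx hxρ Complex.I d2 (vecPot2_eq α β ρ x)
  rw [energyOp, Pi.add_apply, (kin_congr e1).1, (kin_congr e2).2]
  refine (congrArg₂ (· + ·) s1 s2).trans ?_
  rw [f1, f2]
  -- Passing from v = 1 to v = i turns (p, q) = (Re(v/x), Im(v/x)) into (-q, p). Hence p² - q² and
  -- pq cancel in the sum of the two components, together with all first-derivative terms, and p² +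
  -- q² = |x|^{-2} remains.
  have hre : (Complex.I / x).re = -(1 / x).im := by
    rw [div_eq_mul_inv, one_div, Complex.mul_re, Complex.I_re, Complex.I_im]; ring
  have him : (Complex.I / x).im = (1 / x).re := by
    rw [div_eq_mul_inv, one_div, Complex.mul_im, Complex.I_re, Complex.I_im]; ring
  have hsq : ((‖x‖ : ℂ) ^ 2)⁻¹ = ((1 / x).re : ℂ) ^ 2 + ((1 / x).im : ℂ) ^ 2 := by
    have h0 := Complex.normSq_eq_norm_sq (1 / x)
    rw [Complex.normSq_apply, norm_div, norm_one, one_div, one_div, inv_pow] at h0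
    have h1 := congrArg (fun s : ℝ => (s : ℂ)) h0
    push_cast at h1
    rw [← h1]
    simp only [one_div]
    ring
  rw [hsq, kinProfile, kinProfile, hre, him]
  push_cast
  linear_combination
    ((((1 / x).re : ℂ) ^ 2 + ((1 / x).im : ℂ) ^ 2) * deriv (deriv k) (Real.log ‖x‖) *
      angularExp m β ρ x) * Complex.I_mul_I

theorem phase_mul_angularExp (m : ℤ) (x : ℂ) :
    phase α β ρ x * angularExp m β ρ x =
      Complex.exp (Complex.I * ((m + α) * Complex.arg x)) := by
  rw [phase, angularExp, thetaA, thetaB, ← Complex.exp_add]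
  congr 1
  ring

theorem conj_mem_testOn {T : ℝ} {g : ℝ → ℂ} (hg : g ∈ testOn T) :
    (fun t => conj (g t)) ∈ testOn T := by
  obtain ⟨hs, a, b, hb, h⟩ := hg
  exact ⟨Complex.conjCLE.contDiff.comp hs, a, b, hb, fun t ht => h t fun h0 => ht (by simp [h0])⟩

theorem deriv_conj_eq {g : ℝ → ℂ} (hg : Differentiable ℝ g) :
    deriv (fun t => conj (g t)) = fun t => conj (deriv g t) := by
  funext t
  exact (Complex.conjCLE.hasFDerivAt.comp_hasDerivAt t (hg t).hasDerivAt).deriv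

/-- The weak equation implies the radial weak equations near the vortex `0`. -/
theorem IsWeakSolution.isRadialWeakSolution {z : ℂ} {ψ : ℂ → ℂ} (hρ : 0 < ρ)
    (h : IsWeakSolution z α β ρ ψ) : IsRadialWeakSolution z (min (Real.log ρ) 0) α ψ := by
  intro m g hg
  set T := min (Real.log ρ) 0
  have hT : T ≤ 0 := min_le_right _ _
  have hTρ : T ≤ Real.log ρ := min_le_left _ _
  -- The test function enters the weak equation conjugated, so the radial factor is taken to be the
  -- conjugate of g.
  have hk := conj_mem_testOn hg
  have h0 := h _ (isTest_radialTest (β := β) m hT hTρ hρ hk)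
  rw [← neg_eq_zero, ← integral_neg, ← h0]
  refine integral_congr_ae ?_
  filter_upwards [compl_mem_ae_iff.2 (measure_singleton (0 : ℂ))] with x hx
  have hx0 : x ≠ 0 := hx
  -- Outside the disk of radius ρ both integrands vanish; inside it the formula for the separated
  -- operator applies.
  by_cases hxρ : ρ ≤ ‖x‖
  · have hz := radialTest_eventually_zero (β := β) m hT hTρ hρ hk (Or.inr hxρ)
    have ht : T ≤ Real.log ‖x‖ := hTρ.trans (Real.log_le_log hρ hxρ)
    rw [energyOp_eq_zero hz, hz.eq_of_nhds, modeOp, apply_eq_zero_of_mem_testOn hg ht,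
      apply_eq_zero_of_mem_testOn (deriv_mem_testOn (deriv_mem_testOn hg)) ht]
    simp
  · have hd : Differentiable ℝ g := hg.1.differentiable (by simp)
    have hd' : Differentiable ℝ (deriv g) :=
      (deriv_mem_testOn hg).1.differentiable (by simp)
    rw [energyOp_radialTest m hk.1 hx0 (re_lt_of_norm_lt (not_le.1 hxρ)), deriv_conj_eq hd,
      deriv_conj_eq hd', radialTest]
    have e1 : ∀ u w : ℂ, phase α β ρ x * (u * angularExp m β ρ x - w * angularExp m β ρ x) =
        Complex.exp (Complex.I * ((m + α) * Complex.arg x)) * (u - w) := by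
      intro u w
      rw [← phase_mul_angularExp (β := β) (ρ := ρ)]
      ring
    rw [← mul_assoc (conj z), e1, map_mul, ← Complex.exp_conj]
    simp only [map_mul, map_sub, map_neg, map_inv₀, map_pow, map_add, Complex.conj_I,
      Complex.conj_ofReal, Complex.conj_conj, map_intCast]
    rw [modeOp]
    have hn : (‖x‖ : ℂ) ≠ 0 := by simpa using hx0
    have e2 : Complex.exp (2 * (Real.log ‖x‖ : ℝ)) = (‖x‖ : ℂ) ^ 2 := by
      have h3 : Real.exp (2 * Real.log ‖x‖) = ‖x‖ ^ 2 := by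
        rw [mul_comm, Real.exp_mul, Real.exp_log (norm_pos_iff.2 hx0)]
        norm_cast
      rw [← Complex.ofReal_pow, ← h3]
      push_cast
      rfl
    rw [e2]
    field_simp
    ring

/-- Convergence along 𝓝 p ⊓ ae is exactly that the essential supremum over small disks around p
tends to 0. The point p is discarded as a null set, since log 0 = 0 does not reflect its distance.
-/
theorem tendsto_of_ae_norm_le {f : ℂ → ℂ} {a C₀ C₁ S s : ℝ} (ha0 : 0 < a) (ha1 : a < 1) {p : ℂ}
    (h : ∀ᵐ x : ℂ, Real.log ‖x - p‖ < s →
      ‖f x‖ ≤ C₀ * ‖x - p‖ ^ a + C₁ * ‖x - p‖ ^ (1 - a) + S * ‖x - p‖) :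
    Tendsto f (𝓝 p ⊓ ae volume) (𝓝 0) := by
  have hg : Tendsto (fun x : ℂ => C₀ * ‖x - p‖ ^ a + C₁ * ‖x - p‖ ^ (1 - a) + S * ‖x - p‖)
      (𝓝 p) (𝓝 0) := by
    have hc : Continuous fun x : ℂ =>
        C₀ * ‖x - p‖ ^ a + C₁ * ‖x - p‖ ^ (1 - a) + S * ‖x - p‖ := by
      have : Continuous fun x : ℂ => ‖x - p‖ := by fun_prop
      exact ((continuous_const.mul (this.rpow_const fun _ => Or.inr ha0.le)).add
        (continuous_const.mul (this.rpow_const fun _ => Or.inr (by linarith)))).add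
          (continuous_const.mul this)
    refine hc.tendsto' p 0 ?_
    simp [Real.zero_rpow ha0.ne', Real.zero_rpow (show 1 - a ≠ 0 by linarith)]
  refine squeeze_zero_norm' ?_ (hg.mono_left inf_le_left)
  have hball : ∀ᶠ x : ℂ in 𝓝 p, ‖x - p‖ < Real.exp s := by
    have : Tendsto (fun x : ℂ => ‖x - p‖) (𝓝 p) (𝓝 0) :=
      Continuous.tendsto' (by fun_prop) p 0 (by simp)
    exact this.eventually (eventually_lt_nhds (Real.exp_pos s))
  have hne : ∀ᵐ x : ℂ, x ≠ p := compl_mem_ae_iff.2 (measure_singleton p)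
  filter_upwards [hball.filter_mono inf_le_left, h.filter_mono inf_le_right,
    hne.filter_mono inf_le_right] with x h1 h2 h3
  exact h2 ((Real.log_lt_iff_lt_exp (norm_pos_iff.2 (sub_ne_zero.2 h3))).2 h1)

end AharonovBohm

theorem mainTheorem6 (α β ρ : ℝ) (hα0 : 0 < α) (hα1 : α < 1) (hβ0 : 0 < β) (hβ1 : β < 1)
    (hρ : 0 < ρ) (z : ℂ) (hz : ∀ t : ℝ, 0 ≤ t → z ≠ (t : ℂ))
    (ψ : AharonovBohm.L2) (hψ : ψ ∈ AharonovBohm.deficiencySpace α β ρ z) :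
    ∃ ca0 ca1 cb0 cb1 : ℂ,
      Tendsto (fun x : ℂ => ψ x -
          (ca0 * ((‖x‖ ^ (-α) : ℝ) : ℂ) *
              Complex.exp (Complex.I * α * AharonovBohm.thetaA x) +
            ca1 * ((‖x‖ ^ (-1 + α) : ℝ) : ℂ) *
              Complex.exp (Complex.I * (α - 1) * AharonovBohm.thetaA x)))
        (𝓝 (0 : ℂ) ⊓ ae volume) (𝓝 0) ∧
      Tendsto (fun x : ℂ => ψ x -
          (cb0 * ((‖x - ρ‖ ^ (-β) : ℝ) : ℂ) *
              Complex.exp (Complex.I * β * AharonovBohm.thetaB ρ x) +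
            cb1 * ((‖x - ρ‖ ^ (-1 + β) : ℝ) : ℂ) *
              Complex.exp (Complex.I * (β - 1) * AharonovBohm.thetaB ρ x)))
        (𝓝 (ρ : ℂ) ⊓ ae volume) (𝓝 0) := by
  have hw := AharonovBohm.isWeakSolution_of_mem_deficiencySpace hψ
  have hsm : StronglyMeasurable ψ := Lp.stronglyMeasurable ψ
  have hmp : MeasurePreserving (fun x : ℂ => (ρ : ℂ) - x) volume volume :=
    Measure.measurePreserving_sub_left volume (ρ : ℂ)
  obtain ⟨ca0, ca1, A₀, A₁, A, hA⟩ := AharonovBohm.exists_singular_expansion hα0 hα1 hsm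
    (Lp.memLp ψ) (hw.isRadialWeakSolution hρ)
  -- The same expansion at the origin, for ψ(ρ - x) and with the fluxes exchanged.
  obtain ⟨cb0, cb1, B₀, B₁, B, hB⟩ := AharonovBohm.exists_singular_expansion hβ0 hβ1
    (hsm.comp_measurable hmp.measurable) ((Lp.memLp ψ).comp_measurePreserving hmp)
    (hw.reflect.isRadialWeakSolution hρ)
  refine ⟨ca0, ca1, cb0, cb1, ?_, ?_⟩
  · refine AharonovBohm.tendsto_of_ae_norm_le (p := 0) hα0 hα1 (C₀ := A₀) (C₁ := A₁) (S := A)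
      (s := min (Real.log ρ) 0 - 2) ?_
    simpa only [sub_zero, AharonovBohm.thetaA] using hA
  · refine AharonovBohm.tendsto_of_ae_norm_le (p := (ρ : ℂ)) hβ0 hβ1 (C₀ := B₀) (C₁ := B₁)
      (S := B) (s := min (Real.log ρ) 0 - 2) ?_
    -- The half-turn preserves null sets and is its own inverse, so composing with it once more
    -- returns to ψ.
    have hB' := hmp.quasiMeasurePreserving.ae hB
    simpa only [Function.comp_apply, sub_sub_cancel, norm_sub_rev (ρ : ℂ),
      AharonovBohm.thetaB] using hB'
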